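/- For a partition $\pi$ of $n$, let its rank be its largest part minus its number of parts. Let $\omega(\pi)$ be the number of parts of $\pi$ equal to $1$; the crank of $\pi$ is its largest part if $\omega(\pi)=0$, and otherwise it is the number of parts of $\pi$ larger than $\omega(\pi)$, minus $\omega(\pi)$. Let $N(m,n)$ be the number of partitions of $n$ with rank $m$. For $n\neq 1$ let $M(m,n)$ be the number of partitions of $n$ with crank $m$; for $n=1$ put $M(-1,1)=1$, $M(0,1)=-1$, $M(1,1)=1$ and $M(m,1)=0$ otherwise. For $k\ge 1$ define the symmetrized rank and crank moments $$\eta_k(n)=\sum_{m=-n}^{n}\binom{m+\lfloor\frac{k-1}{2}\rfloor}{k}N(m,n),\qquad \mu_k(n)=\sum_{m=-n}^{n}\binom{m+\lfloor\frac{k-1}{2}\rfloor}{k}M(m,n),$$ where $\binom{x}{k}=x(x-1)\cdots(x-k+1)/k!$ for every integer $x$. Write $(a;q)_\infty=\prod_{i\ge 0}(1-aq^i)$. Then for every integer $k\ge 1$ the following identity of formal power series in $\mathbb{Z}[[q]]$ holds, where the multiple sum on the right converges coefficientwise: $$\sum_{n=1}^\infty\bigl(\mu_{2k}(n)-\eta_{2k}(n)\bigr)q^n=\sum_{n_k\ge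 n_{k-1}\ge\cdots\ge n_1\ge 1}\frac{q^{n_1+n_2+\cdots+n_k}}{(1-q^{n_k})^2(1-q^{n_{k-1}})^2\cdots(1-q^{n_1})^2\,(q^{n_1+1};q)_\infty}.$$ Moreover (Andrews' identity, to which the case $k=1$ reduces), for every $n\ge 1$, $$\mathrm{spt}(n)=n\,p(n)-\tfrac12 N_2(n),$$ where $p(n)$ is the number of partitions of $n$, $\mathrm{spt}(n)$ is the total number of occurrences of the smallest part in all partitions of $n$, and $N_2(n)=\sum_{m=-n}^{n}m^2N(m,n)$ is the second rank moment. -/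

import Mathlib

open PowerSeries
open scoped PowerSeries.WithPiTopology

namespace SptK

/-- Dyson's rank of a partition: the largest part minus the number of parts. -/
def rank {n : ℕ} (p : n.Partition) : ℤ :=
  (p.parts.sup : ℤ) - (Multiset.card p.parts : ℤ)

/-- The Andrews–Garvan crank of a partition. Let `ω` be the number of ones. If `ω = 0`, the crank
is the largest part; otherwise it is the number of parts larger than `ω`, minus `ω`. -/
def crank {n : ℕ} (p : n.Partition) : ℤ :=
  if p.parts.count 1 = 0 then (p.parts.sup : ℤ)
  else (Multiset.card (p.parts.filter (fun a => p.parts.count 1 < a)) : ℤ)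
    - (p.parts.count 1 : ℤ)

/-- `N(m,n)`: the number of partitions of `n` with rank `m`. -/
def N (m : ℤ) (n : ℕ) : ℤ :=
  (Fintype.card {p : n.Partition // rank p = m} : ℤ)

/-- `M(m,n)`: the number of partitions of `n` with crank `m` if `n ≠ 1`, while
`M(-1,1) = 1`, `M(0,1) = -1`, `M(1,1) = 1` and `M(m,1) = 0` otherwise. -/
def M (m : ℤ) (n : ℕ) : ℤ :=
  if n = 1 then
    if m = -1 then 1 else if m = 0 then -1 else if m = 1 then 1 else 0
  else (Fintype.card {p : n.Partition // crank p = m} : ℤ)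

/-- The symmetrized rank moment
`η_k(n) = ∑_{m=-n}^{n} binom(m + ⌊(k-1)/2⌋, k) N(m,n)`.
`Ring.choose x k` is `x(x-1)⋯(x-k+1)/k!` for every integer `x`. -/
noncomputable def eta (k n : ℕ) : ℤ :=
  ∑ m ∈ Finset.Icc (-(n : ℤ)) n, Ring.choose (m + ((k : ℤ) - 1) / 2) k * N m n

/-- The symmetrized crank moment
`μ_k(n) = ∑_{m=-n}^{n} binom(m + ⌊(k-1)/2⌋, k) M(m,n)`. -/
noncomputable def mu (k n : ℕ) : ℤ :=
  ∑ m ∈ Finset.Icc (-(n : ℤ)) n, Ring.choose (m + ((k : ℤ) - 1) / 2) k * M m n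

/-- The second rank moment `N_2(n) = ∑_{m=-n}^{n} m² N(m,n)`. -/
noncomputable def rankMomentTwo (n : ℕ) : ℤ :=
  ∑ m ∈ Finset.Icc (-(n : ℤ)) n, m ^ 2 * N m n

/-- `spt(n)`: the total number of occurrences of the smallest part, over all partitions of `n`. -/
noncomputable def spt (n : ℕ) : ℕ :=
  ∑ p : n.Partition, p.parts.count (sInf {a : ℕ | a ∈ p.parts})

/-- `(a;q)_∞ = ∏_{i ≥ 0} (1 - a q^i)` in `ℤ⟦q⟧`, an infinite product in the topology of
coefficientwise convergence. -/
noncomputable def qPochInf (a : ℤ⟦X⟧) : ℤ⟦X⟧ :=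
  ∏' i : ℕ, (1 - a * X ^ i)

/-- The index set of the multiple sum: `k`-tuples with `1 ≤ n_1 ≤ n_2 ≤ ⋯ ≤ n_k`
(the entry `n_{i+1}` is the value at `i : Fin k`). -/
abbrev Index (k : ℕ) : Type :=
  {n : Fin k → ℕ // Monotone n ∧ ∀ i, 1 ≤ n i}

/-- The summand
`q^{n_1+⋯+n_k} / ((1-q^{n_k})² ⋯ (1-q^{n_1})² (q^{n_1+1};q)_∞)` in `ℤ⟦q⟧`.
The denominator has constant coefficient `1`, and `invOfUnit _ 1` is its inverse. -/
noncomputable def summand {k : ℕ} (hk : 1 ≤ k) (n : Index k) : ℤ⟦X⟧ :=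
  X ^ (∑ i, n.1 i) *
    invOfUnit ((∏ i, (1 - X ^ (n.1 i)) ^ 2) * qPochInf (X ^ (n.1 ⟨0, hk⟩ + 1))) 1

end SptK

/-!
Put `z = 1 + ε` in the generating functions of the rank and the crank over all partitions, and let
`T n = (q ^ (n + 1); q)_∞ ^ 2 / ((z q ^ (n + 1); q)_∞ (z⁻¹ q ^ (n + 1); q)_∞)`. Heine's
transformation writes the rank generating function as `1 + ∑ q ^ (n + 1) T n / (q ^ (n + 1); q)_∞`,
and summation by parts turns the difference crank minus rank into
`∑ (T n - T (n + 1)) / (q ^ (n + 2); q)_∞`. Here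
`T n - T (n + 1) = (z - 2 + z⁻¹) · q ^ (n + 1) / (1 - q ^ (n + 1)) ^ 2 · T n`.

The symmetrized moments of order `2 k` are the coefficients of `ε ^ (2 k)` in `(1 + ε) ^ (k - 1)`
times these generating functions, and since `z - 2 + z⁻¹ = ε ^ 2 / (1 + ε)`, multiplication by this
factor lowers `k` by one. Iterating the recurrence for `T n` therefore produces the multiple sum.
For `k = 1` the sum is the generating function of `spt`. The second crank moment is `n p(n)` because
`∑ q ^ m / (1 - q ^ m) ^ 2 = ∑ m q ^ m / (1 - q ^ m)`, and the second rank moment appears because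
the first one vanishes, as the difference crank minus rank is divisible by `ε ^ 2`.
-/

namespace SptK

open Filter Topology Finset
open scoped Ring

section Convergence

variable {R : Type*} [CommRing R]

theorem X_pow_dvd_sub_iff {N : ℕ} {f g : R⟦X⟧} :
    X ^ N ∣ f - g ↔ ∀ d < N, coeff d f = coeff d g := by
  simp only [X_pow_dvd_iff, map_sub, sub_eq_zero]

variable [TopologicalSpace R]

theorem tendsto_of_X_pow_dvd_sub {u : ℕ → R⟦X⟧} {f : R⟦X⟧} (h : ∀ n, X ^ n ∣ u n - f) :
    Tendsto u atTop (𝓝 f) := by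
  rw [WithPiTopology.tendsto_iff_coeff_tendsto]
  exact fun d ↦ tendsto_atTop_of_eventually_const (i₀ := d + 1) fun n hn ↦
    X_pow_dvd_sub_iff.1 (h n) d hn

theorem X_pow_dvd_sub_of_tendsto [T2Space R] {u : ℕ → R⟦X⟧} {f g : R⟦X⟧} {N : ℕ}
    (hu : Tendsto u atTop (𝓝 f)) (h : ∀ᶠ n in atTop, X ^ N ∣ u n - g) : X ^ N ∣ f - g := by
  refine X_pow_dvd_sub_iff.2 fun d hd ↦ tendsto_nhds_unique
    ((WithPiTopology.tendsto_iff_coeff_tendsto R _ _ _).1 hu d)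
    (tendsto_const_nhds.congr' ?_)
  filter_upwards [h] with n hn
  exact (X_pow_dvd_sub_iff.1 hn d hd).symm

theorem summable_of_X_pow_dvd {ι : Type*} {f : ι → R⟦X⟧} (wt : ι → ℕ)
    (hwt : ∀ d, {i | wt i ≤ d}.Finite) (hf : ∀ i, X ^ wt i ∣ f i) : Summable f := by
  rw [WithPiTopology.summable_iff_summable_coeff]
  refine fun d ↦ summable_of_hasFiniteSupport ((hwt d).subset fun i hi ↦ ?_)
  by_contra hlt
  exact hi (X_pow_dvd_iff.1 (hf i) d (not_le.1 hlt))

theorem summable_nat_of_X_pow_dvd {f : ℕ → R⟦X⟧} (hf : ∀ n, X ^ n ∣ f n) : Summable f :=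
  summable_of_X_pow_dvd id Set.finite_le_nat hf

theorem multipliable_of_X_pow_dvd_sub_one {f : ℕ → R⟦X⟧} (hf : ∀ n, X ^ n ∣ f n - 1) :
    Multipliable f := by
  suffices h : Tendsto (fun n ↦ (f n - 1).order) atTop (𝓝 ⊤) by
    simpa using WithPiTopology.multipliable_one_add_of_tendsto_order_atTop_nhds_top R h
  refine ENat.tendsto_nhds_top_iff_natCast_lt.2 fun N ↦ ?_
  filter_upwards [eventually_gt_atTop N] with n hn
  exact lt_of_lt_of_le (Nat.cast_lt.2 hn) (nat_le_order _ _ (X_pow_dvd_iff.1 (hf n)))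

theorem hasSum_sub_succ [T2Space R] [IsTopologicalRing R] {u : ℕ → R⟦X⟧} {f : R⟦X⟧}
    (hu : ∀ n, X ^ n ∣ u n - f) : HasSum (fun n ↦ u n - u (n + 1)) (u 0 - f) := by
  have hs : Summable fun n ↦ u n - u (n + 1) := summable_nat_of_X_pow_dvd fun n ↦ by
    rw [← sub_sub_sub_cancel_right _ _ f]
    exact dvd_sub (hu n) ((pow_dvd_pow X n.le_succ).trans (hu (n + 1)))
  rw [hs.hasSum_iff_tendsto_nat]
  simp only [sum_range_sub']
  exact tendsto_const_nhds.sub (tendsto_of_X_pow_dvd_sub hu)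

theorem hasSum_comm_of_X_pow_dvd [T2Space R] [IsTopologicalRing R] {f : ℕ → ℕ → R⟦X⟧}
    {row col : ℕ → R⟦X⟧} {s : R⟦X⟧} (hf : ∀ m n, X ^ (m + n) ∣ f m n)
    (hrow : ∀ m, HasSum (f m) (row m)) (hcol : ∀ n, HasSum (fun m ↦ f m n) (col n))
    (hs : HasSum col s) : HasSum row s := by
  have hsum : Summable fun p : ℕ × ℕ ↦ f p.1 p.2 := by
    refine summable_of_X_pow_dvd (fun p ↦ p.1 + p.2) (fun d ↦ ?_) fun p ↦ hf p.1 p.2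
    refine ((Set.finite_le_nat d).prod (Set.finite_le_nat d)).subset fun p hp ↦ ?_
    simp only [Set.mem_ofPred_eq, Set.mem_prod] at hp ⊢
    omega
  have hcols := ((Equiv.prodComm ℕ ℕ).hasSum_iff.2 hsum.hasSum).prod_fiberwise hcol
  rw [hs.unique hcols]
  exact hsum.hasSum.prod_fiberwise hrow

end Convergence

section Inverse

variable {R : Type*} [CommRing R]

theorem isUnit_of_constantCoeff_eq_one {f : R⟦X⟧} (hf : constantCoeff f = 1) : IsUnit f :=
  isUnit_iff_constantCoeff.2 (hf ▸ isUnit_one)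

theorem invOfUnit_one_eq_inverse {f : R⟦X⟧} (hf : constantCoeff f = 1) :
    invOfUnit f 1 = f⁻¹ʳ := by
  rw [← one_mul f⁻¹ʳ, Ring.eq_mul_inverse_iff_mul_eq _ _ _ (isUnit_of_constantCoeff_eq_one hf)]
  exact invOfUnit_mul f 1 (by rw [hf, Units.val_one])

theorem map_inverse_of_isUnit {S : Type*} [CommRing S] (φ : R →+* S) {a : R} (ha : IsUnit a) :
    φ a⁻¹ʳ = (φ a)⁻¹ʳ := by
  rw [← one_mul (φ a)⁻¹ʳ, Ring.eq_mul_inverse_iff_mul_eq _ _ _ (ha.map φ), ← map_mul,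
    Ring.inverse_mul_cancel _ ha, map_one]

theorem dvd_mul_sub_one {a b c : R} (hb : a ∣ b - 1) (hc : a ∣ c - 1) : a ∣ b * c - 1 := by
  rw [show b * c - 1 = (b - 1) * c + (c - 1) by ring]
  exact dvd_add (hb.mul_right _) hc

theorem dvd_inverse_sub_one {a b : R} (hb : IsUnit b) (h : a ∣ b - 1) : a ∣ b⁻¹ʳ - 1 := by
  rw [show b⁻¹ʳ - 1 = -(b - 1) * b⁻¹ʳ by linear_combination Ring.mul_inverse_cancel b hb]
  exact h.neg_right.mul_right _

theorem isUnit_one_sub_of_X_dvd {f : R⟦X⟧} (hf : X ∣ f) : IsUnit (1 - f) :=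
  isUnit_of_constantCoeff_eq_one (by simp [X_dvd_iff.1 hf])

variable [TopologicalSpace R] [T2Space R] [IsTopologicalRing R]

theorem hasSum_pow_succ {f : R⟦X⟧} (hf : X ∣ f) :
    HasSum (fun n : ℕ ↦ f ^ (n + 1)) (f * (1 - f)⁻¹ʳ) := by
  have hinv := Ring.mul_inverse_cancel _ (isUnit_one_sub_of_X_dvd hf)
  convert hasSum_sub_succ (u := fun n ↦ f ^ (n + 1) * (1 - f)⁻¹ʳ) (f := 0) fun n ↦ ?_ using 1
  · funext n
    linear_combination (-f ^ (n + 1)) * hinv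
  · ring
  · rw [sub_zero, pow_succ]
    exact ((pow_dvd_pow_of_dvd hf n).mul_right _).mul_right _

theorem hasSum_succ_mul_pow_succ {f : R⟦X⟧} (hf : X ∣ f) :
    HasSum (fun n : ℕ ↦ ((n + 1 : ℕ) : R⟦X⟧) * f ^ (n + 1)) (f * ((1 - f) ^ 2)⁻¹ʳ) := by
  have hinv := Ring.mul_inverse_cancel _ ((isUnit_one_sub_of_X_dvd hf).pow 2)
  convert hasSum_sub_succ (f := 0)
    (u := fun n : ℕ ↦ f ^ (n + 1) * ((n + 1 - n * f : R⟦X⟧) * ((1 - f) ^ 2)⁻¹ʳ)) fun n ↦ ?_ using 1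
  · funext n
    push_cast
    linear_combination (-((n : R⟦X⟧) + 1) * f ^ (n + 1)) * hinv
  · simp
  · rw [sub_zero, pow_succ]
    exact ((pow_dvd_pow_of_dvd hf n).mul_right _).mul_right _

end Inverse

section QSeries

variable {R : Type*} [CommRing R]

/-- The finite `q`-Pochhammer product `(cq; q)_n`. The base is shifted by `q` so that the constant
term is `1` for every power series `c`. -/
noncomputable def qProd (c : R⟦X⟧) (n : ℕ) : R⟦X⟧ := ∏ i ∈ range n, (1 - c * X ^ (i + 1))

@[simp]
theorem qProd_zero (c : R⟦X⟧) : qProd c 0 = 1 := prod_range_zero _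

@[simp]
theorem qProd_zero_left (n : ℕ) : qProd (0 : R⟦X⟧) n = 1 := by simp [qProd]

theorem qProd_succ (c : R⟦X⟧) (n : ℕ) : qProd c (n + 1) = qProd c n * (1 - c * X ^ (n + 1)) :=
  prod_range_succ _ _

theorem qProd_add (c : R⟦X⟧) (m n : ℕ) : qProd c (m + n) = qProd c m * qProd (c * X ^ m) n := by
  rw [qProd, prod_range_add]
  congr 1
  exact prod_congr rfl fun i _ ↦ by ring

theorem X_pow_dvd_qProd_sub_one (c : R⟦X⟧) (m n : ℕ) : X ^ (m + 1) ∣ qProd (c * X ^ m) n - 1 := by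
  induction n with
  | zero => simp
  | succ n ih =>
    rw [qProd_succ]
    exact dvd_mul_sub_one ih (Dvd.intro (-(c * X ^ n)) (by ring))

@[simp]
theorem constantCoeff_qProd (c : R⟦X⟧) (n : ℕ) : constantCoeff (qProd c n) = 1 := by
  rw [qProd, map_prod]
  exact prod_eq_one fun i _ ↦ by simp

theorem isUnit_qProd (c : R⟦X⟧) (n : ℕ) : IsUnit (qProd c n) :=
  isUnit_of_constantCoeff_eq_one (constantCoeff_qProd c n)

theorem qProd_mul_inverse (c : R⟦X⟧) (n : ℕ) : qProd c n * (qProd c n)⁻¹ʳ = 1 :=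
  Ring.mul_inverse_cancel _ (isUnit_qProd c n)

/-- The coefficient `(aq; q)_n / (q; q)_n` of the `q`-binomial series. -/
noncomputable def qBinomCoeff (a : R⟦X⟧) (n : ℕ) : R⟦X⟧ := qProd a n * (qProd 1 n)⁻¹ʳ

@[simp]
theorem qBinomCoeff_zero (a : R⟦X⟧) : qBinomCoeff a 0 = 1 := by simp [qBinomCoeff]

theorem qBinomCoeff_succ (a : R⟦X⟧) (n : ℕ) :
    qBinomCoeff a (n + 1) * (1 - X ^ (n + 1)) = qBinomCoeff a n * (1 - a * X ^ (n + 1)) := by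
  have hX : IsUnit (1 - X ^ (n + 1) : R⟦X⟧) :=
    isUnit_one_sub_of_X_dvd (dvd_pow_self X n.succ_ne_zero)
  rw [qBinomCoeff, qBinomCoeff, qProd_succ, qProd_succ, one_mul, Ring.mul_inverse_rev]
  linear_combination (qProd a n * (1 - a * X ^ (n + 1)) * (qProd 1 n)⁻¹ʳ) *
    Ring.mul_inverse_cancel _ hX

variable [TopologicalSpace R]

/-- The infinite `q`-Pochhammer product `(cq; q)_∞`. -/
noncomputable def qProdInf (c : R⟦X⟧) : R⟦X⟧ := ∏' i : ℕ, (1 - c * X ^ (i + 1))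

@[simp]
theorem qProdInf_zero : qProdInf (0 : R⟦X⟧) = 1 := by simp [qProdInf]

/-- The `q`-binomial series `∑ (aq; q)_n / (q; q)_n (tq)^n`. -/
noncomputable def qBinomSeries (a t : R⟦X⟧) : R⟦X⟧ := ∑' n : ℕ, qBinomCoeff a n * (t * X) ^ n

theorem hasSum_qBinomSeries (a t : R⟦X⟧) :
    HasSum (fun n ↦ qBinomCoeff a n * (t * X) ^ n) (qBinomSeries a t) :=
  (summable_nat_of_X_pow_dvd fun n ↦
    Dvd.intro_left (qBinomCoeff a n * t ^ n) (by ring)).hasSum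

/-- The series `∑_{n ≥ 1} z^{n-1} q^n / (wq; q)_n`, the generating function of the rank over
nonempty partitions, arranged by largest part, when `z * w = 1`. -/
noncomputable def rankSeries (z w : R⟦X⟧) : R⟦X⟧ :=
  ∑' n : ℕ, z ^ n * X ^ (n + 1) * (qProd w (n + 1))⁻¹ʳ

theorem hasSum_rankSeries (z w : R⟦X⟧) :
    HasSum (fun n : ℕ ↦ z ^ n * X ^ (n + 1) * (qProd w (n + 1))⁻¹ʳ) (rankSeries z w) :=
  (summable_nat_of_X_pow_dvd fun n ↦
    Dvd.intro_left (z ^ n * X * (qProd w (n + 1))⁻¹ʳ) (by ring)).hasSum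

theorem hasProd_qProdInf [T2Space R] (c : R⟦X⟧) :
    HasProd (fun i ↦ 1 - c * X ^ (i + 1)) (qProdInf c) :=
  (multipliable_of_X_pow_dvd_sub_one fun n ↦ Dvd.intro (-(c * X)) (by ring)).hasProd

variable [T2Space R]

theorem tendsto_qProd (c : R⟦X⟧) : Tendsto (qProd c) atTop (𝓝 (qProdInf c)) :=
  (hasProd_qProdInf c).tendsto_prod_nat

theorem X_pow_dvd_qProdInf_sub_one (c : R⟦X⟧) (n : ℕ) : X ^ (n + 1) ∣ qProdInf (c * X ^ n) - 1 :=
  X_pow_dvd_sub_of_tendsto (tendsto_qProd _) (.of_forall (X_pow_dvd_qProd_sub_one c n))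

@[simp]
theorem constantCoeff_qProdInf (c : R⟦X⟧) : constantCoeff (qProdInf c) = 1 := by
  simpa [X_dvd_iff, sub_eq_zero] using X_pow_dvd_qProdInf_sub_one c 0

theorem isUnit_qProdInf (c : R⟦X⟧) : IsUnit (qProdInf c) :=
  isUnit_of_constantCoeff_eq_one (constantCoeff_qProdInf c)

theorem qProdInf_mul_inverse (c : R⟦X⟧) : qProdInf c * (qProdInf c)⁻¹ʳ = 1 :=
  Ring.mul_inverse_cancel _ (isUnit_qProdInf c)

theorem X_pow_dvd_qBinomSeries_sub_one (a t : R⟦X⟧) (n : ℕ) :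
    X ^ n ∣ qBinomSeries a (t * X ^ n) - 1 := by
  refine X_pow_dvd_sub_of_tendsto (hasSum_qBinomSeries a (t * X ^ n)).tendsto_sum_nat ?_
  filter_upwards [eventually_ge_atTop 1] with N hN
  obtain ⟨N, rfl⟩ := Nat.exists_eq_add_of_le' hN
  rw [sum_range_succ', qBinomCoeff_zero, pow_zero, mul_one, add_sub_cancel_right]
  exact dvd_sum fun i _ ↦
    Dvd.intro (qBinomCoeff a (i + 1) * t * X * (t * X ^ n * X) ^ i) (by ring)

variable [IsTopologicalRing R]

theorem qProdInf_eq_qProd_mul (c : R⟦X⟧) (n : ℕ) :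
    qProdInf c = qProd c n * qProdInf (c * X ^ n) := by
  refine tendsto_nhds_unique ((tendsto_add_atTop_iff_nat n).2 (tendsto_qProd c))
    (((tendsto_qProd (c * X ^ n)).const_mul (qProd c n)).congr fun k ↦ ?_)
  rw [← qProd_add, add_comm]

theorem qProdInf_mul_X_pow (c : R⟦X⟧) (n : ℕ) :
    qProdInf (c * X ^ n) = (1 - c * X ^ (n + 1)) * qProdInf (c * X ^ (n + 1)) := by
  rw [qProdInf_eq_qProd_mul _ 1, qProd_succ, qProd_zero]
  ring_nf

theorem inverse_qProdInf_eq_mul (c : R⟦X⟧) (n : ℕ) :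
    (qProdInf c)⁻¹ʳ = (qProd c n)⁻¹ʳ * (qProdInf (c * X ^ n))⁻¹ʳ := by
  rw [qProdInf_eq_qProd_mul c n, Ring.mul_inverse_rev, mul_comm]

theorem inverse_qProdInf_mul_X_pow (c : R⟦X⟧) (n : ℕ) :
    (qProdInf (c * X ^ n))⁻¹ʳ * (1 - c * X ^ (n + 1)) = (qProdInf (c * X ^ (n + 1)))⁻¹ʳ := by
  have hunit : IsUnit (1 - c * X ^ (n + 1)) :=
    isUnit_one_sub_of_X_dvd (Dvd.intro_left (c * X ^ n) (by ring))
  rw [qProdInf_mul_X_pow, Ring.mul_inverse_rev, mul_assoc, Ring.inverse_mul_cancel _ hunit,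
    mul_one]

theorem one_sub_mul_qBinomSeries (a t : R⟦X⟧) :
    (1 - t * X) * qBinomSeries a t = (1 - a * t * X ^ 2) * qBinomSeries a (t * X) := by
  have htel := hasSum_sub_succ (f := 0)
    (u := fun n ↦ qBinomCoeff a n * (t * X) ^ n * (1 - X ^ n)) fun n ↦
      Dvd.intro (qBinomCoeff a n * t ^ n * (1 - X ^ n)) (by ring)
  have hdiff := ((hasSum_qBinomSeries a t).mul_left (1 - t * X)).sub
    ((hasSum_qBinomSeries a (t * X)).mul_left (1 - a * t * X ^ 2))
  rw [← sub_eq_zero]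
  convert hdiff.unique (htel.congr_fun _) using 1
  · simp
  · intro n
    linear_combination (t * X) ^ (n + 1) * qBinomCoeff_succ a n

theorem qBinomSeries_mul_qProd (a t : R⟦X⟧) (n : ℕ) :
    qBinomSeries a t * qProd t n = qProd (a * t * X) n * qBinomSeries a (t * X ^ n) := by
  induction n with
  | zero => simp
  | succ n ih =>
    have h := one_sub_mul_qBinomSeries a (t * X ^ n)
    rw [mul_assoc t, ← pow_succ] at h
    rw [qProd_succ, qProd_succ]
    linear_combination (1 - t * X ^ (n + 1)) * ih + qProd (a * t * X) n * h

theorem qBinomSeries_eq (a t : R⟦X⟧) :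
    qBinomSeries a t = qProdInf (a * t * X) * (qProdInf t)⁻¹ʳ := by
  rw [Ring.eq_mul_inverse_iff_mul_eq _ _ _ (isUnit_qProdInf t)]
  refine tendsto_nhds_unique ((tendsto_qProd t).const_mul (qBinomSeries a t)) ?_
  simp only [qBinomSeries_mul_qProd]
  simpa using (tendsto_qProd (a * t * X)).mul
    (tendsto_of_X_pow_dvd_sub (X_pow_dvd_qBinomSeries_sub_one a t))

theorem hasSum_inverse_qProdInf (t : R⟦X⟧) :
    HasSum (fun n ↦ (qProd 1 n)⁻¹ʳ * (t * X) ^ n) (qProdInf t)⁻¹ʳ := by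
  simpa [qBinomSeries_eq, qBinomCoeff] using hasSum_qBinomSeries 0 t

theorem hasSum_heine_row (z w : R⟦X⟧) (m : ℕ) :
    HasSum (fun n ↦ qProdInf z * qBinomCoeff w m * X ^ (m + 1) *
      ((qProd 1 n)⁻¹ʳ * (z * X ^ m * X) ^ n)) (qProd z m * qBinomCoeff w m * X ^ (m + 1)) := by
  have hval : qProd z m * qBinomCoeff w m * X ^ (m + 1) =
      qProdInf z * qBinomCoeff w m * X ^ (m + 1) * (qProdInf (z * X ^ m))⁻¹ʳ := by
    rw [qProdInf_eq_qProd_mul z m]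
    linear_combination (-qProd z m * qBinomCoeff w m * X ^ (m + 1)) *
      qProdInf_mul_inverse (z * X ^ m)
  rw [hval]
  have heuler := hasSum_inverse_qProdInf (z * X ^ m)
  exact heuler.mul_left _

theorem hasSum_heine_col (z w : R⟦X⟧) (n : ℕ) :
    HasSum (fun m ↦ qProdInf z * qBinomCoeff w m * X ^ (m + 1) *
      ((qProd 1 n)⁻¹ʳ * (z * X ^ m * X) ^ n))
      (qProdInf z * qProdInf w * (qProdInf 1)⁻¹ʳ *
        (z ^ n * X ^ (n + 1) * (qProd w (n + 1))⁻¹ʳ)) := by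
  have hval : qProdInf z * qProdInf w * (qProdInf 1)⁻¹ʳ *
      (z ^ n * X ^ (n + 1) * (qProd w (n + 1))⁻¹ʳ) =
      qProdInf z * (qProd 1 n)⁻¹ʳ * z ^ n * X ^ (n + 1) * qBinomSeries w (X ^ n) := by
    rw [qBinomSeries_eq, inverse_qProdInf_eq_mul 1 n, one_mul, mul_assoc w,
      ← pow_succ, qProdInf_eq_qProd_mul w (n + 1)]
    linear_combination (qProdInf z * qProdInf (w * X ^ (n + 1)) * (qProd 1 n)⁻¹ʳ *
      (qProdInf (X ^ n))⁻¹ʳ * z ^ n * X ^ (n + 1)) *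
      qProd_mul_inverse w (n + 1)
  rw [hval]
  exact ((hasSum_qBinomSeries w (X ^ n)).mul_left _).congr_fun fun m ↦ by ring

/-- The case of Heine's transformation obtained by writing `(zq; q)_n = (zq; q)_∞ / (zq^{n+1}; q)_∞`
and expanding the reciprocal by Euler's identity. -/
theorem hasSum_heine (z w : R⟦X⟧) :
    HasSum (fun n ↦ qProd z n * qBinomCoeff w n * X ^ (n + 1))
      (qProdInf z * qProdInf w * (qProdInf 1)⁻¹ʳ * rankSeries z w) :=
  hasSum_comm_of_X_pow_dvd
    (fun m n ↦ Dvd.intro_left (qProdInf z * qBinomCoeff w m * X *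
      ((qProd 1 n)⁻¹ʳ * (z * X ^ m) ^ n)) (by ring))
    (hasSum_heine_row z w) (hasSum_heine_col z w) ((hasSum_rankSeries z w).mul_left _)

end QSeries

section RankCrank

variable {R : Type*} [CommRing R]

theorem one_sub_X_mul_inverse_qProd_one (n : ℕ) :
    (1 - X) * (qProd (1 : R⟦X⟧) (n + 1))⁻¹ʳ = (qProd X n)⁻¹ʳ := by
  have hsplit : qProd (1 : R⟦X⟧) (n + 1) = (1 - X) * qProd X n := by
    rw [add_comm, qProd_add, qProd_succ]
    simp
  rw [hsplit, Ring.mul_inverse_rev, mul_left_comm,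
    Ring.mul_inverse_cancel _ (isUnit_one_sub_of_X_dvd dvd_rfl), mul_one]

variable [TopologicalSpace R]

/-- The product `(q; q)_∞ / ((zq; q)_∞ (wq; q)_∞)`, which generates the crank when
`z * w = 1`. -/
noncomputable def crankSeries (z w : R⟦X⟧) : R⟦X⟧ :=
  qProdInf 1 * (qProdInf z)⁻¹ʳ * (qProdInf w)⁻¹ʳ

/-- The product `(q^{n+1}; q)_∞² / ((zq^{n+1}; q)_∞ (wq^{n+1}; q)_∞)`, whose consecutive
differences carry the factor `z - 2 + w`. -/
noncomputable def crankTail (z w : R⟦X⟧) (n : ℕ) : R⟦X⟧ :=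
  qProdInf (X ^ n) ^ 2 * (qProdInf (z * X ^ n))⁻¹ʳ * (qProdInf (w * X ^ n))⁻¹ʳ

theorem crankTail_zero (z w : R⟦X⟧) : crankTail z w 0 = qProdInf 1 * crankSeries z w := by
  simp only [crankTail, crankSeries, pow_zero, mul_one]
  ring

variable [T2Space R]

theorem X_pow_dvd_inverse_qProdInf_sub_one (c : R⟦X⟧) (n : ℕ) :
    X ^ n ∣ (qProdInf (c * X ^ n))⁻¹ʳ - 1 :=
  dvd_inverse_sub_one (isUnit_qProdInf _)
    ((pow_dvd_pow X n.le_succ).trans (X_pow_dvd_qProdInf_sub_one c n))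

theorem X_pow_dvd_crankTail_sub_one (z w : R⟦X⟧) (n : ℕ) : X ^ n ∣ crankTail z w n - 1 := by
  have hq : X ^ n ∣ qProdInf (X ^ n : R⟦X⟧) - 1 := by
    simpa using (pow_dvd_pow X n.le_succ).trans (X_pow_dvd_qProdInf_sub_one (1 : R⟦X⟧) n)
  rw [crankTail, pow_two]
  exact dvd_mul_sub_one (dvd_mul_sub_one (dvd_mul_sub_one hq hq)
    (X_pow_dvd_inverse_qProdInf_sub_one z n)) (X_pow_dvd_inverse_qProdInf_sub_one w n)

variable [IsTopologicalRing R]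

theorem qProdInf_X_pow (n : ℕ) :
    qProdInf (X ^ n : R⟦X⟧) = (1 - X ^ (n + 1)) * qProdInf (X ^ (n + 1)) := by
  simpa using qProdInf_mul_X_pow (1 : R⟦X⟧) n

theorem crankTail_succ_mul (z w : R⟦X⟧) (n : ℕ) :
    crankTail z w (n + 1) * (1 - X ^ (n + 1)) ^ 2
      = crankTail z w n * ((1 - z * X ^ (n + 1)) * (1 - w * X ^ (n + 1))) := by
  simp only [crankTail]
  rw [← inverse_qProdInf_mul_X_pow z n, ← inverse_qProdInf_mul_X_pow w n, qProdInf_X_pow n]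
  ring

theorem crankTail_sub_crankTail_succ {z w : R⟦X⟧} (hzw : z * w = 1) (n : ℕ) :
    crankTail z w n - crankTail z w (n + 1) =
      (z - 2 + w) * (X ^ (n + 1) * ((1 - X ^ (n + 1)) ^ 2)⁻¹ʳ * crankTail z w n) := by
  have hinv : (1 - (X : R⟦X⟧) ^ (n + 1)) ^ 2 * ((1 - X ^ (n + 1)) ^ 2)⁻¹ʳ = 1 :=
    Ring.mul_inverse_cancel _
      ((isUnit_one_sub_of_X_dvd (dvd_pow_self X n.succ_ne_zero)).pow 2)
  linear_combination (-((1 - (X : R⟦X⟧) ^ (n + 1)) ^ 2)⁻¹ʳ) * crankTail_succ_mul z w n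
    - (crankTail z w n - crankTail z w (n + 1)) * hinv -
    crankTail z w n * ((1 - (X : R⟦X⟧) ^ (n + 1)) ^ 2)⁻¹ʳ * X ^ (2 * (n + 1)) * hzw

theorem hasSum_crankTail_sub_succ (z w : R⟦X⟧) (n : ℕ) :
    HasSum (fun i ↦ crankTail z w (n + i) - crankTail z w (n + i + 1)) (crankTail z w n - 1) :=
  hasSum_sub_succ (u := fun i ↦ crankTail z w (n + i)) fun i ↦
    (pow_dvd_pow X (Nat.le_add_left i n)).trans (X_pow_dvd_crankTail_sub_one z w (n + i))

theorem crankTail_mul_inverse_qProdInf (z w : R⟦X⟧) (n : ℕ) :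
    crankTail z w n * (qProdInf (X ^ n))⁻¹ʳ =
      crankSeries z w * (qProd z n * qBinomCoeff w n) := by
  have hq := qProdInf_eq_qProd_mul (1 : R⟦X⟧) n
  rw [one_mul] at hq
  rw [crankTail, crankSeries, qBinomCoeff, hq, inverse_qProdInf_eq_mul z n,
    inverse_qProdInf_eq_mul w n]
  calc _ = (qProdInf (X ^ n) * (qProdInf (X ^ n))⁻¹ʳ) *
        (qProdInf (X ^ n) * (qProdInf (z * X ^ n))⁻¹ʳ * (qProdInf (w * X ^ n))⁻¹ʳ) := by ring
    _ = (qProd 1 n * (qProd 1 n)⁻¹ʳ) * (qProd z n * (qProd z n)⁻¹ʳ) *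
        (qProd w n * (qProd w n)⁻¹ʳ) *
        (qProdInf (X ^ n) * (qProdInf (z * X ^ n))⁻¹ʳ * (qProdInf (w * X ^ n))⁻¹ʳ) := by
      simp only [qProd_mul_inverse, qProdInf_mul_inverse, one_mul]
    _ = _ := by ring

theorem hasSum_X_pow_mul_crankTail (z w : R⟦X⟧) :
    HasSum (fun n ↦ X ^ (n + 1) * (crankTail z w n * (qProdInf (X ^ n))⁻¹ʳ))
      (rankSeries z w) := by
  have hval : crankSeries z w * (qProdInf z * qProdInf w * (qProdInf 1)⁻¹ʳ * rankSeries z w) =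
      rankSeries z w := by
    calc _ = (qProdInf 1 * (qProdInf 1)⁻¹ʳ) * (qProdInf z * (qProdInf z)⁻¹ʳ) *
          (qProdInf w * (qProdInf w)⁻¹ʳ) * rankSeries z w := by rw [crankSeries]; ring
      _ = rankSeries z w := by
        simp only [qProdInf_mul_inverse, one_mul]
  have hheine := (hasSum_heine z w).mul_left (crankSeries z w)
  rw [hval] at hheine
  refine hheine.congr_fun fun n ↦ ?_
  rw [crankTail_mul_inverse_qProdInf]
  ring

theorem hasSum_crankSeries_sub_rankSeries (z w : R⟦X⟧) :
    HasSum (fun n ↦ (crankTail z w n - crankTail z w (n + 1)) * (qProdInf (X ^ (n + 1)))⁻¹ʳ)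
      (crankSeries z w - 1 - rankSeries z w) := by
  have htel := hasSum_sub_succ (u := fun n ↦ crankTail z w n * (qProdInf (X ^ n))⁻¹ʳ) (f := 1)
    fun n ↦ dvd_mul_sub_one (X_pow_dvd_crankTail_sub_one z w n)
      (by simpa using X_pow_dvd_inverse_qProdInf_sub_one (1 : R⟦X⟧) n)
  have hzero : crankTail z w 0 * (qProdInf (X ^ 0))⁻¹ʳ = crankSeries z w := by
    rw [crankTail_mul_inverse_qProdInf, qProd_zero, qBinomCoeff_zero, mul_one, mul_one]
  rw [hzero] at htel
  refine (htel.sub (hasSum_X_pow_mul_crankTail z w)).congr_fun fun n ↦ ?_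
  have hsucc := inverse_qProdInf_mul_X_pow (1 : R⟦X⟧) n
  simp only [one_mul] at hsucc
  linear_combination (-crankTail z w n) * hsucc

theorem hasSum_crank_without_ones (z : R⟦X⟧) :
    HasSum (fun n ↦ (qProd X (n + 1))⁻¹ʳ * (z * X) ^ (n + 2))
      ((1 - X) * (qProdInf z)⁻¹ʳ - (1 - X) - z * X) := by
  have hval : (1 - X) * (qProdInf z)⁻¹ʳ - (1 - X) - z * X = (1 - X) * (qProdInf z)⁻¹ʳ -
      ∑ n ∈ range 2, (1 - X) * ((qProd 1 n)⁻¹ʳ * (z * X) ^ n) := by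
    rw [sum_range_succ, sum_range_one, ← mul_assoc _ _ ((z * X) ^ 1),
      one_sub_X_mul_inverse_qProd_one]
    simp only [qProd_zero, Ring.inverse_one, pow_zero, mul_one, pow_one, one_mul]
    ring
  rw [hval]
  refine ((hasSum_nat_add_iff' 2).2
    ((hasSum_inverse_qProdInf z).mul_left (1 - X))).congr_fun fun n ↦ ?_
  rw [← one_sub_X_mul_inverse_qProd_one]
  ring

theorem hasSum_crank_with_ones {z w : R⟦X⟧} (hzw : z * w = 1) :
    HasSum (fun n ↦ (qProd X n)⁻¹ʳ * (w * X) ^ (n + 1) * (qProdInf (z * X ^ (n + 1)))⁻¹ʳ)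
      (crankSeries z w - (1 - X) * (qProdInf z)⁻¹ʳ) := by
  have hval : crankSeries z w - (1 - X) * (qProdInf z)⁻¹ʳ =
      (1 - X) * (qProdInf z)⁻¹ʳ * qBinomSeries z w -
      ∑ n ∈ range 1, (1 - X) * (qProdInf z)⁻¹ʳ * (qBinomCoeff z n * (w * X) ^ n) := by
    have hq := qProdInf_X_pow (R := R) 0
    rw [pow_zero, zero_add, pow_one] at hq
    rw [sum_range_one, qBinomSeries_eq, hzw, one_mul, crankSeries, hq, qBinomCoeff_zero]
    ring
  rw [hval]
  refine ((hasSum_nat_add_iff' 1).2 ((hasSum_qBinomSeries z w).mul_left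
    ((1 - X) * (qProdInf z)⁻¹ʳ))).congr_fun fun n ↦ ?_
  rw [inverse_qProdInf_eq_mul z (n + 1), qBinomCoeff, ← one_sub_X_mul_inverse_qProd_one]
  linear_combination (-((1 - X) * (qProd 1 (n + 1))⁻¹ʳ * (w * X) ^ (n + 1) *
    (qProdInf (z * X ^ (n + 1)))⁻¹ʳ)) * qProd_mul_inverse z (n + 1)

end RankCrank

section PartitionSeries

variable {R : Type*} [CommRing R]

/-- The generating function `∑ wt(π) q^{|π|}` over all partitions `π`. A weight is a function of the
multiset of parts, so that it can be compared at partitions of different integers. -/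
noncomputable def partitionSeries (wt : Multiset ℕ → R) : R⟦X⟧ :=
  PowerSeries.mk fun d ↦ ∑ p : d.Partition, wt p.parts

theorem coeff_partitionSeries (wt : Multiset ℕ → R) (d : ℕ) :
    coeff d (partitionSeries wt) = ∑ p : d.Partition, wt p.parts := coeff_mk _ _

theorem partitionSeries_congr {wt wt' : Multiset ℕ → R}
    (h : ∀ s : Multiset ℕ, (∀ a ∈ s, 0 < a) → wt s = wt' s) :
    partitionSeries wt = partitionSeries wt' := by
  ext d
  simp only [coeff_partitionSeries]
  exact sum_congr rfl fun p _ ↦ h _ fun _ ↦ p.parts_pos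

theorem partitionSeries_add (wt wt' : Multiset ℕ → R) :
    partitionSeries (fun s ↦ wt s + wt' s) = partitionSeries wt + partitionSeries wt' := by
  ext d
  simp only [map_add, coeff_partitionSeries, sum_add_distrib]

theorem partitionSeries_const_mul (c : R) (wt : Multiset ℕ → R) :
    partitionSeries (fun s ↦ c * wt s) = C c * partitionSeries wt := by
  ext d
  simp only [coeff_C_mul, coeff_partitionSeries, mul_sum]

theorem partitionSeries_eq_C {wt : Multiset ℕ → R} (h : ∀ s ≠ 0, wt s = 0) :
    partitionSeries wt = C (wt 0) := by
  ext d
  rw [coeff_partitionSeries, coeff_C]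
  split_ifs with hd
  · subst hd
    rw [Fintype.sum_unique, Nat.Partition.partition_zero_parts]
  · refine sum_eq_zero fun p _ ↦ h _ fun hp ↦ hd ?_
    rw [← p.parts_sum, hp, Multiset.sum_zero]

theorem partitionSeries_ite_mem {m : ℕ} (hm : 0 < m) (wt : Multiset ℕ → R) :
    partitionSeries (fun s ↦ if m ∈ s then wt s else 0) =
      X ^ m * partitionSeries fun s ↦ wt (m ::ₘ s) := by
  ext d
  rw [coeff_X_pow_mul', coeff_partitionSeries, ← sum_filter]
  split_ifs with hmd
  · rw [coeff_partitionSeries, ← sum_subtype_eq_sum_filter, subtype_univ,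
      ← (Nat.Partition.partitionWithPartEquiv hm hmd).symm.sum_comp]
    simp only [Nat.Partition.partitionWithPartEquiv_symm_apply_parts]
  · refine sum_eq_zero fun p hp ↦ absurd ?_ hmd
    exact Nat.Partition.le_of_mem_parts (mem_filter.1 hp).2

theorem partitionSeries_ite_count_eq {m : ℕ} (hm : 0 < m) (c : ℕ) (wt : Multiset ℕ → R) :
    partitionSeries (fun s ↦ if s.count m = c then wt s else 0) = X ^ (m * c) *
      partitionSeries fun s ↦ if s.count m = 0 then wt (Multiset.replicate c m + s) else 0 := by
  induction c generalizing wt with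
  | zero => simp
  | succ c ih =>
    have hmem : partitionSeries (fun s ↦ if s.count m = c + 1 then wt s else 0) =
        partitionSeries fun s ↦ if m ∈ s then if s.count m = c + 1 then wt s else 0 else 0 := by
      refine partitionSeries_congr fun s _ ↦ ?_
      by_cases hs : m ∈ s <;> simp [hs]
    simp only [hmem, partitionSeries_ite_mem hm, Multiset.count_cons_self, add_left_inj, ih,
      Multiset.replicate_succ, Multiset.cons_add, mul_add_one, pow_add]
    ring

theorem partitionSeries_count_succ_mul {m : ℕ} (hm : 0 < m) {wt : Multiset ℕ → R}
    (hwt : ∀ s, wt (m ::ₘ s) = wt s) :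
    partitionSeries (fun s ↦ (s.count m + 1) * wt s) =
      (1 - X ^ m)⁻¹ʳ * partitionSeries wt := by
  have hcount : partitionSeries (fun s ↦ s.count m * wt s) =
      X ^ m * partitionSeries fun s ↦ (s.count m + 1) * wt s := by
    calc partitionSeries (fun s ↦ s.count m * wt s)
        = partitionSeries fun s ↦ if m ∈ s then s.count m * wt s else 0 := by
          refine partitionSeries_congr fun s _ ↦ ?_
          by_cases hs : m ∈ s <;> simp [hs]
      _ = _ := by simp [partitionSeries_ite_mem hm, hwt]
  have hsplit : partitionSeries (fun s ↦ (s.count m + 1) * wt s) =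
      partitionSeries (fun s ↦ s.count m * wt s) + partitionSeries wt := by
    simp only [add_mul, one_mul, partitionSeries_add]
  rw [mul_comm, Ring.eq_mul_inverse_iff_mul_eq _ _ _
    (isUnit_one_sub_of_X_dvd (dvd_pow_self X hm.ne'))]
  linear_combination hsplit + hcount

theorem partitionSeries_count {m : ℕ} (hm : 0 < m) :
    partitionSeries (fun s ↦ (s.count m : R)) =
      X ^ m * (1 - X ^ m)⁻¹ʳ * partitionSeries fun _ ↦ 1 := by
  have hmem : partitionSeries (fun s ↦ (s.count m : R)) =
      partitionSeries fun s ↦ if m ∈ s then (s.count m : R) else 0 := by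
    refine partitionSeries_congr fun s _ ↦ ?_
    by_cases hs : m ∈ s <;> simp [hs]
  have hsucc := partitionSeries_count_succ_mul (R := R) hm (wt := fun _ ↦ 1) fun _ ↦ rfl
  simp only [mul_one] at hsucc
  simp only [hmem, partitionSeries_ite_mem hm, Multiset.count_cons_self, Nat.cast_succ, hsucc,
    mul_assoc]

variable [TopologicalSpace R] [IsTopologicalRing R]

theorem hasSum_partitionSeries_fiber (stat : Multiset ℕ → ℕ) (wt : Multiset ℕ → R) :
    HasSum (fun n ↦ partitionSeries fun s ↦ if stat s = n then wt s else 0)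
      (partitionSeries wt) := by
  rw [WithPiTopology.hasSum_iff_hasSum_coeff]
  intro d
  simp only [coeff_partitionSeries, eq_comm (a := stat _)]
  exact hasSum_sum fun p _ ↦ hasSum_ite_eq (stat p.parts) (wt p.parts)

theorem hasSum_partitionSeries_count_one (wt : Multiset ℕ → R) :
    HasSum (fun j ↦ X ^ j *
        partitionSeries fun s ↦ if s.count 1 = 0 then wt (Multiset.replicate j 1 + s) else 0)
      (partitionSeries wt) :=
  (hasSum_partitionSeries_fiber (Multiset.count 1) wt).congr_fun fun j ↦ by
    rw [partitionSeries_ite_count_eq one_pos j, one_mul]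

theorem hasSum_partitionSeries_of_mem {stat : Multiset ℕ → ℕ} (hzero : stat 0 = 0)
    (hmem : ∀ s ≠ 0, stat s ∈ s) (wt : Multiset ℕ → R) :
    HasSum (fun n ↦ X ^ (n + 1) * partitionSeries fun s ↦
        if stat ((n + 1) ::ₘ s) = n + 1 then wt ((n + 1) ::ₘ s) else 0)
      (partitionSeries wt - C (wt 0)) := by
  have hempty : partitionSeries (fun s ↦ if stat s = 0 then wt s else 0) = C (wt 0) := by
    calc partitionSeries (fun s ↦ if stat s = 0 then wt s else 0)
        = partitionSeries fun s ↦ if s = 0 then wt s else 0 := by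
          refine partitionSeries_congr fun s hs ↦ ?_
          by_cases h0 : s = 0
          · rw [if_pos h0, if_pos (h0 ▸ hzero)]
          · rw [if_neg h0, if_neg (hs _ (hmem s h0)).ne']
      _ = C (wt 0) := by rw [partitionSeries_eq_C fun s hs ↦ if_neg hs, if_pos rfl]
  have hsum := (hasSum_nat_add_iff' 1).2 (hasSum_partitionSeries_fiber stat wt)
  rw [sum_range_one, hempty] at hsum
  refine hsum.congr_fun fun n ↦ ?_
  rw [← partitionSeries_ite_mem n.succ_pos fun s ↦ if stat s = n + 1 then wt s else 0]
  refine partitionSeries_congr fun s _ ↦ ?_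
  by_cases hs : stat s = n + 1
  · have hs0 : s ≠ 0 := by
      rintro rfl
      omega
    have hs1 := hmem s hs0
    rw [hs] at hs1
    rw [if_pos hs1]
  · simp [hs]

theorem hasSum_partitionSeries_largest_part (wt : Multiset ℕ → R) :
    HasSum (fun n ↦ X ^ (n + 1) * partitionSeries fun s ↦
        if s.sup ≤ n + 1 then wt ((n + 1) ::ₘ s) else 0)
      (partitionSeries wt - C (wt 0)) := by
  have hmem (s : Multiset ℕ) (hs : s ≠ 0) : s.sup ∈ s := by
    obtain ⟨a, has, ha⟩ := Multiset.exists_max_image id (s := s) hs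
    rwa [le_antisymm (Multiset.sup_le.2 ha) (Multiset.le_sup has)]
  simpa using hasSum_partitionSeries_of_mem Multiset.sup_zero hmem wt

theorem sInf_mem_cons_eq_iff (n : ℕ) (s : Multiset ℕ) :
    sInf {a | a ∈ (n + 1) ::ₘ s} = n + 1 ↔ ∀ a ∈ s, n < a := by
  constructor
  · intro h a ha
    exact h.ge.trans (Nat.sInf_le (Multiset.mem_cons_of_mem ha))
  · intro h
    refine le_antisymm (Nat.sInf_le (Multiset.mem_cons_self _ _))
      (le_csInf ⟨n + 1, Multiset.mem_cons_self _ _⟩ fun a ha ↦ ?_)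
    exact (Multiset.mem_cons.1 ha).elim ge_of_eq (h a)

theorem hasSum_partitionSeries_smallest_part (wt : Multiset ℕ → R) :
    HasSum (fun n ↦ X ^ (n + 1) * partitionSeries fun s ↦
        if ∀ a ∈ s, n < a then wt ((n + 1) ::ₘ s) else 0)
      (partitionSeries wt - C (wt 0)) := by
  have hsum := hasSum_partitionSeries_of_mem (stat := fun s ↦ sInf {a | a ∈ s}) (by simp)
    (fun s hs ↦ Nat.sInf_mem (Multiset.exists_mem_of_ne_zero hs)) wt
  simpa only [sInf_mem_cons_eq_iff] using hsum

end PartitionSeries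

section ProductWeights

variable {R : Type*} [CommRing R]

theorem prod_map_two_step (m l : ℕ) (u v : R) (s : Multiset ℕ) :
    (s.map fun a ↦ if a ≤ m then 0 else if a ≤ m + l then u else v).prod =
      if ∀ a ∈ s, m < a then
        u ^ (s.filter (· ≤ m + l)).card * v ^ (s.filter (m + l < ·)).card else 0 := by
  induction s using Multiset.induction with
  | empty => simp
  | cons a s ih =>
    rw [Multiset.map_cons, Multiset.prod_cons, ih]
    rcases lt_or_ge m a with hm | hm
    · rcases lt_or_ge (m + l) a with hl | hl
      · simp only [Multiset.forall_mem_cons, hm, hm.not_ge, hl, hl.not_ge, if_false, true_and,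
          Multiset.filter_cons_of_neg, not_false_eq_true, Multiset.filter_cons_of_pos,
          Multiset.card_cons, pow_succ', mul_ite, mul_zero, mul_left_comm]
      · simp only [Multiset.forall_mem_cons, hm, hm.not_ge, hl, hl.not_gt, if_false, if_true,
          true_and, Multiset.filter_cons_of_neg, not_false_eq_true, Multiset.filter_cons_of_pos,
          Multiset.card_cons, pow_succ', mul_ite, mul_zero, mul_assoc]
    · simp [hm, hm.not_gt]

theorem pow_card_filter_mul_zero_pow (n : ℕ) (u : R) (s : Multiset ℕ) :
    u ^ (s.filter (· ≤ n)).card * 0 ^ (s.filter (n < ·)).card =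
      if s.sup ≤ n then u ^ s.card else 0 := by
  by_cases h : s.sup ≤ n
  · have hle := Multiset.sup_le.1 h
    rw [if_pos h, Multiset.filter_eq_self.2 hle,
      Multiset.filter_eq_nil.2 fun a ha ↦ (hle a ha).not_gt, Multiset.card_zero, pow_zero, mul_one]
  · rw [if_neg h, zero_pow, mul_zero]
    simpa [Multiset.filter_eq_nil, Multiset.sup_le] using h

theorem forall_one_lt_iff {s : Multiset ℕ} (hs : ∀ a ∈ s, 0 < a) :
    (∀ a ∈ s, 1 < a) ↔ s.count 1 = 0 := by
  rw [Multiset.count_eq_zero]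
  refine ⟨fun h h1 ↦ (h 1 h1).false, fun h a ha ↦ lt_of_le_of_ne (hs a ha) ?_⟩
  rintro rfl
  exact h ha

variable [TopologicalSpace R] [T2Space R] [IsTopologicalRing R]

theorem partitionSeries_prod_map {g : ℕ → R} {Q : R⟦X⟧} (hunit : IsUnit Q)
    (hQ : HasProd (fun i ↦ 1 - C (g (i + 1)) * X ^ (i + 1)) Q) :
    partitionSeries (fun s ↦ (s.map g).prod) = Q⁻¹ʳ := by
  have hgen : partitionSeries (fun s ↦ (s.map g).prod) =
      Nat.Partition.genFun fun i c ↦ g i ^ c := by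
    ext d
    rw [coeff_partitionSeries, Nat.Partition.coeff_genFun]
    refine sum_congr rfl fun p _ ↦ ?_
    simp only [prod_multiset_map_count, Finsupp.prod, Multiset.toFinsupp_support,
      Multiset.toFinsupp_apply]
  have hfactor (i : ℕ) : (1 + ∑' j, g (i + 1) ^ (j + 1) • (X : R⟦X⟧) ^ ((i + 1) * (j + 1))) *
      (1 - C (g (i + 1)) * X ^ (i + 1)) = 1 := by
    have hX : (X : R⟦X⟧) ∣ C (g (i + 1)) * X ^ (i + 1) :=
      Dvd.intro_left (C (g (i + 1)) * X ^ i) (by ring)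
    have hgeom := (hasSum_pow_succ hX).tsum_eq
    simp only [smul_eq_C_mul, map_pow, pow_mul, ← mul_pow, hgeom]
    linear_combination (C (g (i + 1)) * X ^ (i + 1)) *
      Ring.mul_inverse_cancel _ (isUnit_one_sub_of_X_dvd hX)
  rw [hgen, ← one_mul Q⁻¹ʳ, Ring.eq_mul_inverse_iff_mul_eq _ _ _ hunit]
  refine ((Nat.Partition.hasProd_genFun _).mul hQ).unique ?_
  simp only [hfactor, hasProd_one]

theorem partitionSeries_two_step (m l : ℕ) (u v : R) :
    partitionSeries (fun s ↦ if ∀ a ∈ s, m < a then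
        u ^ (s.filter (· ≤ m + l)).card * v ^ (s.filter (m + l < ·)).card else 0) =
      (qProd (C u * X ^ m) l * qProdInf (C v * X ^ (m + l)))⁻¹ʳ := by
  simp only [← prod_map_two_step]
  refine partitionSeries_prod_map ((isUnit_qProd _ _).mul (isUnit_qProdInf _)) ?_
  have hprod : qProd (C u * X ^ m) l = ∏ i ∈ range (m + l), (1 - C (if i + 1 ≤ m then 0 else
      if i + 1 ≤ m + l then u else v) * X ^ (i + 1)) := by
    rw [prod_range_add, prod_eq_one fun i hi ↦ ?_, one_mul, qProd]
    · refine prod_congr rfl fun i hi ↦ ?_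
      have hil := mem_range.1 hi
      rw [if_neg (by omega), if_pos (by omega)]
      ring
    · rw [if_pos (Nat.succ_le_of_lt (mem_range.1 hi)), map_zero, zero_mul, sub_zero]
  rw [hprod]
  refine ((hasProd_qProdInf (C v * X ^ (m + l))).congr_fun fun i ↦ ?_).prod_range_mul
  rw [if_neg (by omega), if_neg (by omega)]
  ring

theorem partitionSeries_sup_le (n : ℕ) (u : R) :
    partitionSeries (fun s ↦ if s.sup ≤ n then u ^ s.card else 0) = (qProd (C u) n)⁻¹ʳ := by
  have h := partitionSeries_two_step 0 n u 0
  simp only [pow_card_filter_mul_zero_pow, zero_add, pow_zero, mul_one, map_zero, zero_mul,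
    qProdInf_zero] at h
  rw [← h]
  exact partitionSeries_congr fun s hs ↦ (if_pos hs).symm

theorem partitionSeries_sup_le_without_ones (n : ℕ) :
    partitionSeries (fun s ↦ if s.sup ≤ n + 1 then if s.count 1 = 0 then (1 : R) else 0 else 0) =
      (qProd X n)⁻¹ʳ := by
  have h := partitionSeries_two_step 1 n (1 : R) 0
  simp only [pow_card_filter_mul_zero_pow] at h
  simp only [one_pow, map_one, pow_one, one_mul, map_zero, zero_mul, qProdInf_zero, mul_one] at h
  rw [← h]
  refine partitionSeries_congr fun s hs ↦ ?_
  simp only [forall_one_lt_iff hs, add_comm 1 n]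
  split_ifs <;> rfl

theorem partitionSeries_without_ones (n : ℕ) (v : R) :
    partitionSeries (fun s ↦ if s.count 1 = 0 then v ^ (s.filter (n + 1 < ·)).card else 0) =
      (qProd X n)⁻¹ʳ * (qProdInf (C v * X ^ (n + 1)))⁻¹ʳ := by
  have h := partitionSeries_two_step 1 n 1 v
  simp only [one_pow, one_mul, map_one, pow_one, Ring.mul_inverse_rev, add_comm 1 n] at h
  rw [mul_comm, ← h]
  exact partitionSeries_congr fun s hs ↦ by simp only [forall_one_lt_iff hs]

theorem partitionSeries_forall_lt (n : ℕ) :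
    partitionSeries (fun s ↦ if ∀ a ∈ s, n < a then (1 : R) else 0) = (qProdInf (X ^ n))⁻¹ʳ := by
  have h := partitionSeries_two_step n 0 (1 : R) 1
  simpa using h

theorem partitionSeries_one : partitionSeries (fun _ ↦ (1 : R)) = (qProdInf 1)⁻¹ʳ := by
  rw [← pow_zero X, ← partitionSeries_forall_lt]
  exact partitionSeries_congr fun s hs ↦ (if_pos hs).symm

end ProductWeights

section RankCrankSeries

/-- The rank as a function of the multiset of parts, so that it can serve as the exponent of a
weight in a `partitionSeries`. -/
def partsRank (s : Multiset ℕ) : ℤ := (s.sup : ℤ) - s.card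

/-- The crank as a function of the multiset of parts, so that it can serve as the exponent of a
weight in a `partitionSeries`. -/
def partsCrank (s : Multiset ℕ) : ℤ :=
  if s.count 1 = 0 then (s.sup : ℤ) else ((s.filter (s.count 1 < ·)).card : ℤ) - s.count 1

theorem partsRank_cons {n : ℕ} {s : Multiset ℕ} (hs : s.sup ≤ n + 1) :
    partsRank ((n + 1) ::ₘ s) = n - s.card := by
  rw [partsRank, Multiset.sup_cons, sup_eq_left.2 hs, Multiset.card_cons]
  push_cast
  ring

theorem partsCrank_of_count_one_eq_zero {s : Multiset ℕ} (hs : s.count 1 = 0) :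
    partsCrank s = s.sup := if_pos hs

theorem partsCrank_replicate_one_add (j : ℕ) {s : Multiset ℕ} (hs : s.count 1 = 0) :
    partsCrank (Multiset.replicate (j + 1) 1 + s) =
      (s.filter (j + 1 < ·)).card - (j + 1 : ℕ) := by
  have hcount : (Multiset.replicate (j + 1) 1 + s).count 1 = j + 1 := by
    rw [Multiset.count_add, Multiset.count_replicate_self, hs, add_zero]
  have hfilter : (Multiset.replicate (j + 1) 1).filter (j + 1 < ·) = 0 := by
    rw [Multiset.filter_eq_nil]
    intro a ha
    rw [Multiset.eq_of_mem_replicate ha]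
    omega
  rw [partsCrank, hcount, if_neg (Nat.succ_ne_zero j), Multiset.filter_add, hfilter, zero_add]

variable {R : Type*} [CommRing R] [TopologicalSpace R] [T2Space R] [IsTopologicalRing R]

theorem partitionSeries_zpow_partsRank (z : Rˣ) :
    partitionSeries (fun s ↦ ((z ^ partsRank s : Rˣ) : R)) =
      1 + rankSeries (C (z : R)) (C ((z⁻¹ : Rˣ) : R)) := by
  have hterm (n : ℕ) : X ^ (n + 1) * (partitionSeries fun s ↦
        if s.sup ≤ n + 1 then ((z ^ partsRank ((n + 1) ::ₘ s) : Rˣ) : R) else 0) =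
      C (z : R) ^ n * X ^ (n + 1) * (qProd (C ((z⁻¹ : Rˣ) : R)) (n + 1))⁻¹ʳ := by
    rw [← partitionSeries_sup_le, mul_comm (C _ ^ n), mul_assoc, ← map_pow,
      ← partitionSeries_const_mul]
    congr 2 with s
    rw [mul_ite, mul_zero]
    refine if_ctx_congr Iff.rfl (fun hs ↦ ?_) fun _ ↦ rfl
    rw [partsRank_cons hs, zpow_sub, zpow_natCast, zpow_natCast, ← inv_pow, Units.val_mul,
      Units.val_pow_eq_pow_val, Units.val_pow_eq_pow_val]
  have hsum := (hasSum_partitionSeries_largest_part fun s ↦ ((z ^ partsRank s : Rˣ) : R)).unique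
    ((hasSum_rankSeries _ _).congr_fun hterm)
  have hempty : partsRank 0 = 0 := by simp [partsRank]
  rw [hempty, zpow_zero, Units.val_one, map_one] at hsum
  linear_combination hsum

theorem partitionSeries_pow_sup_without_ones (z : R) :
    partitionSeries (fun s ↦ if s.count 1 = 0 then z ^ s.sup else 0) =
      (1 - X) * (qProdInf (C z))⁻¹ʳ + X - C z * X := by
  let wt (s : Multiset ℕ) : R := if s.count 1 = 0 then z ^ s.sup else 0
  have hempty : wt 0 = 1 := by simp [wt]
  have hone : (partitionSeries fun s ↦ if s.sup ≤ 0 + 1 then wt ((0 + 1) ::ₘ s) else 0) = 0 := by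
    ext d
    simp [coeff_partitionSeries, wt]
  have hterm (n : ℕ) :
      X ^ (n + 2) * (partitionSeries fun s ↦ if s.sup ≤ n + 2 then wt ((n + 2) ::ₘ s) else 0) =
        (qProd X (n + 1))⁻¹ʳ * (C z * X) ^ (n + 2) := by
    rw [← partitionSeries_sup_le_without_ones, mul_pow, ← map_pow, ← mul_assoc,
      mul_comm _ (C _), ← partitionSeries_const_mul, mul_comm]
    congr 2 with s
    by_cases hs : s.sup ≤ n + 2 <;> simp [hs, wt]
  have hsum := (hasSum_nat_add_iff' 1).2 (hasSum_partitionSeries_largest_part wt)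
  rw [sum_range_one, hone, mul_zero, sub_zero, hempty, map_one] at hsum
  have heq := hsum.unique ((hasSum_crank_without_ones (C z)).congr_fun hterm)
  linear_combination heq

theorem partitionSeries_zpow_partsCrank (z : Rˣ) :
    partitionSeries (fun s ↦ ((z ^ partsCrank s : Rˣ) : R)) =
      crankSeries (C (z : R)) (C ((z⁻¹ : Rˣ) : R)) + X - C (z : R) * X := by
  have hzero : (partitionSeries fun s ↦ if s.count 1 = 0 then
      ((z ^ partsCrank (Multiset.replicate 0 1 + s) : Rˣ) : R) else 0) =
        (1 - X) * (qProdInf (C (z : R)))⁻¹ʳ + X - C (z : R) * X := by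
    rw [← partitionSeries_pow_sup_without_ones]
    congr 1 with s
    refine if_ctx_congr Iff.rfl (fun hs ↦ ?_) fun _ ↦ rfl
    rw [Multiset.replicate_zero, zero_add, partsCrank_of_count_one_eq_zero hs, zpow_natCast,
      Units.val_pow_eq_pow_val]
  have hterm (j : ℕ) : X ^ (j + 1) * (partitionSeries fun s ↦ if s.count 1 = 0 then
        ((z ^ partsCrank (Multiset.replicate (j + 1) 1 + s) : Rˣ) : R) else 0) =
      (qProd X j)⁻¹ʳ * (C ((z⁻¹ : Rˣ) : R) * X) ^ (j + 1) *
        (qProdInf (C (z : R) * X ^ (j + 1)))⁻¹ʳ := by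
    rw [mul_right_comm, ← partitionSeries_without_ones, mul_comm (partitionSeries _), mul_pow,
      ← map_pow, mul_comm (C _), mul_assoc, ← partitionSeries_const_mul]
    congr 2 with s
    rw [mul_ite, mul_zero]
    refine if_ctx_congr Iff.rfl (fun hs ↦ ?_) fun _ ↦ rfl
    rw [partsCrank_replicate_one_add j hs, zpow_sub, zpow_natCast, zpow_natCast, ← inv_pow,
      mul_comm, Units.val_mul, Units.val_pow_eq_pow_val, Units.val_pow_eq_pow_val]
  have hsum := (hasSum_nat_add_iff' 1).2
    (hasSum_partitionSeries_count_one fun s ↦ ((z ^ partsCrank s : Rˣ) : R))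
  rw [sum_range_one, hzero, pow_zero, one_mul] at hsum
  have hunit : C (z : R) * C ((z⁻¹ : Rˣ) : R) = 1 := by rw [← map_mul, z.mul_inv, map_one]
  have heq := hsum.unique ((hasSum_crank_with_ones hunit).congr_fun hterm)
  linear_combination heq

end RankCrankSeries

section Moments

theorem card_parts_le {n : ℕ} (p : n.Partition) : p.parts.card ≤ n := by
  have h := Multiset.card_nsmul_le_sum (s := p.parts) (a := 1) fun a ha ↦ p.parts_pos ha
  rwa [p.parts_sum, smul_eq_mul, mul_one] at h

theorem sup_parts_le {n : ℕ} (p : n.Partition) : p.parts.sup ≤ n :=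
  Multiset.sup_le.2 fun _ ha ↦ Nat.Partition.le_of_mem_parts ha

theorem rank_mem_Icc {n : ℕ} (p : n.Partition) : rank p ∈ Icc (-(n : ℤ)) n := by
  have h1 := card_parts_le p
  have h2 := sup_parts_le p
  rw [mem_Icc, rank]
  omega

theorem crank_mem_Icc {n : ℕ} (p : n.Partition) : crank p ∈ Icc (-(n : ℤ)) n := by
  have h1 := card_parts_le p
  have h2 := sup_parts_le p
  have h3 := Multiset.count_le_card 1 p.parts
  have h4 := Multiset.card_le_card (Multiset.filter_le (p.parts.count 1 < ·) p.parts)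
  rw [mem_Icc, crank]
  split_ifs <;> omega

theorem sum_mul_card_fiber {ι κ : Type*} [Fintype ι] [DecidableEq κ] {stat : ι → κ} {s : Finset κ}
    (hstat : ∀ p, stat p ∈ s) (F : κ → ℤ) :
    ∑ m ∈ s, F m * (Fintype.card {p // stat p = m} : ℤ) = ∑ p, F (stat p) := by
  rw [← sum_fiberwise_of_maps_to (fun p _ ↦ hstat p)]
  refine sum_congr rfl fun m _ ↦ ?_
  rw [Fintype.card_subtype, sum_congr rfl (g := fun _ ↦ F m) fun p hp ↦ by
    rw [(mem_filter.1 hp).2], sum_const, nsmul_eq_mul, mul_comm]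

theorem sum_mul_N (n : ℕ) (F : ℤ → ℤ) :
    ∑ m ∈ Icc (-(n : ℤ)) n, F m * N m n = ∑ p : n.Partition, F (rank p) :=
  sum_mul_card_fiber rank_mem_Icc F

theorem crank_partition_one (p : Nat.Partition 1) : crank p = -1 := by
  simp [crank]

theorem sum_mul_M (n : ℕ) (F : ℤ → ℤ) :
    ∑ m ∈ Icc (-(n : ℤ)) n, F m * M m n =
      ∑ p : n.Partition, F (crank p) + if n = 1 then F 1 - F 0 else 0 := by
  split_ifs with hn
  · subst hn
    rw [Fintype.sum_unique, crank_partition_one,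
      show Icc (-((1 : ℕ) : ℤ)) ((1 : ℕ) : ℤ) = {-1, 0, 1} by decide]
    have hM : M (-1) 1 = 1 ∧ M 0 1 = -1 ∧ M 1 1 = 1 := ⟨rfl, rfl, rfl⟩
    rw [sum_insert (by decide), sum_insert (by decide), sum_singleton, hM.1, hM.2.1, hM.2.2]
    ring
  · rw [add_zero, ← sum_mul_card_fiber crank_mem_Icc]
    refine sum_congr rfl fun m _ ↦ ?_
    rw [M, if_neg hn]

theorem eta_two_mul (k n : ℕ) :
    eta (2 * k) n = ∑ p : n.Partition, Ring.choose (rank p + ((k : ℤ) - 1)) (2 * k) := by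
  have h : (((2 * k : ℕ) : ℤ) - 1) / 2 = k - 1 := by omega
  rw [eta, h]
  exact sum_mul_N n fun m ↦ Ring.choose (m + ((k : ℤ) - 1)) (2 * k)

theorem mu_two_mul (k n : ℕ) :
    mu (2 * k) n = ∑ p : n.Partition, Ring.choose (crank p + ((k : ℤ) - 1)) (2 * k) +
      if n = 1 then Ring.choose (1 + ((k : ℤ) - 1)) (2 * k) -
        Ring.choose (0 + ((k : ℤ) - 1)) (2 * k) else 0 := by
  have h : (((2 * k : ℕ) : ℤ) - 1) / 2 = k - 1 := by omega
  rw [mu, h]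
  exact sum_mul_M n fun m ↦ Ring.choose (m + ((k : ℤ) - 1)) (2 * k)

end Moments

section BinomialMoments

theorem binomialSeries_one : binomialSeries ℤ (1 : ℤ) = (1 + X : ℤ⟦X⟧) := by
  simpa using binomialSeries_nat (R := ℤ) (A := ℤ) 1

theorem binomialSeries_mul_neg (e : ℤ) :
    binomialSeries ℤ e * binomialSeries ℤ (-e) = (1 : ℤ⟦X⟧) := by
  rw [← binomialSeries_add, add_neg_cancel, binomialSeries_zero]

/-- The unit `z = 1 + ε` of `ℤ⟦ε⟧`, at which the rank and crank generating functions are expanded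
to read off moments. -/
noncomputable def oneAddEps : ℤ⟦X⟧ˣ where
  val := binomialSeries ℤ (1 : ℤ)
  inv := binomialSeries ℤ (-1 : ℤ)
  val_inv := binomialSeries_mul_neg 1
  inv_val := by rw [mul_comm, binomialSeries_mul_neg]

theorem val_oneAddEps_zpow (m : ℤ) : ((oneAddEps ^ m : ℤ⟦X⟧ˣ) : ℤ⟦X⟧) = binomialSeries ℤ m := by
  induction m with
  | zero => rw [zpow_zero, Units.val_one, binomialSeries_zero]
  | succ n ih => rw [zpow_add_one, Units.val_mul, ih, binomialSeries_add, oneAddEps]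
  | pred n ih =>
    rw [zpow_sub_one, Units.val_mul, ih, sub_eq_add_neg, binomialSeries_add, oneAddEps]
    rfl

/-- The element `z - 2 + z⁻¹ = ε² / (1 + ε)` for `z = 1 + ε`. -/
noncomputable def secondDiff : ℤ⟦X⟧ := oneAddEps - 2 + (oneAddEps⁻¹ : ℤ⟦X⟧ˣ)

theorem binomialSeries_mul_secondDiff (e : ℤ) :
    binomialSeries ℤ (e + 1) * secondDiff = X ^ 2 * binomialSeries ℤ e := by
  have hz : (oneAddEps : ℤ⟦X⟧) = 1 + X := binomialSeries_one
  have hinv : (1 + X) * ((oneAddEps⁻¹ : ℤ⟦X⟧ˣ) : ℤ⟦X⟧) = 1 := by rw [← hz, oneAddEps.mul_inv]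
  rw [binomialSeries_add, secondDiff, hz, binomialSeries_one]
  linear_combination binomialSeries ℤ e * hinv

/-- The coefficient of `ε ^ r` in `(1 + ε) ^ e * f`, taken coefficientwise in the outer variable.
At `f = ∑ (1 + ε) ^ m q ^ n` it produces the moments `∑ choose (m + e) r q ^ n`. -/
noncomputable def binomialMoment (r : ℕ) (e : ℤ) : ℤ⟦X⟧⟦X⟧ →+ ℤ⟦X⟧ where
  toFun f := PowerSeries.mk fun d ↦ coeff r (binomialSeries ℤ e * coeff d f)
  map_zero' := by ext; simp
  map_add' f g := by ext; simp [mul_add]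

theorem coeff_binomialMoment (r : ℕ) (e : ℤ) (f : ℤ⟦X⟧⟦X⟧) (d : ℕ) :
    coeff d (binomialMoment r e f) = coeff r (binomialSeries ℤ e * coeff d f) :=
  coeff_mk d fun d ↦ coeff r (binomialSeries ℤ e * coeff d f)

theorem continuous_binomialMoment (r : ℕ) (e : ℤ) : Continuous (binomialMoment r e) := by
  refine continuous_iff_continuousAt.2 fun f ↦
    (WithPiTopology.tendsto_iff_coeff_tendsto ℤ _ _ _).2 fun d ↦ ?_
  simp only [coeff_binomialMoment]
  exact ((WithPiTopology.continuous_coeff ℤ r).comp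
    (continuous_const.mul (WithPiTopology.continuous_coeff ℤ⟦X⟧ d))).tendsto f

theorem binomialMoment_map_C_mul (r : ℕ) (e : ℤ) (g : ℤ⟦X⟧) (f : ℤ⟦X⟧⟦X⟧) :
    binomialMoment r e (PowerSeries.map C g * f) = g * binomialMoment r e f := by
  ext d
  simp only [coeff_binomialMoment, coeff_mul d, coeff_map, mul_sum, map_sum,
    mul_left_comm (binomialSeries ℤ e), coeff_C_mul]

theorem binomialMoment_secondDiff_mul (r : ℕ) (e : ℤ) (f : ℤ⟦X⟧⟦X⟧) :
    binomialMoment (r + 2) (e + 1) (C secondDiff * f) = binomialMoment r e f := by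
  ext d
  rw [coeff_binomialMoment, coeff_binomialMoment, coeff_C_mul, ← mul_assoc,
    binomialSeries_mul_secondDiff, mul_assoc, coeff_X_pow_mul]

theorem binomialMoment_secondDiff_mul_of_lt {r : ℕ} (hr : r < 2) (e : ℤ) (f : ℤ⟦X⟧⟦X⟧) :
    binomialMoment r e (C secondDiff * f) = 0 := by
  ext d
  have h := binomialSeries_mul_secondDiff (e - 1)
  rw [sub_add_cancel] at h
  rw [coeff_binomialMoment, coeff_C_mul, ← mul_assoc, h, mul_assoc, map_zero]
  exact X_pow_dvd_iff.1 (Dvd.intro _ rfl) r hr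

theorem coeff_binomialSeries_mul (r : ℕ) (e m : ℤ) :
    coeff r (binomialSeries ℤ e * binomialSeries ℤ m) = Ring.choose (m + e) r := by
  rw [← binomialSeries_add, binomialSeries_coeff, smul_eq_mul, mul_one, add_comm]

theorem binomialMoment_one (r : ℕ) (e : ℤ) : binomialMoment r e 1 = C (Ring.choose e r) := by
  ext d
  rw [coeff_binomialMoment, coeff_one, coeff_C]
  split_ifs <;> simp

theorem coeff_binomialMoment_partitionSeries (r : ℕ) (e : ℤ) (stat : Multiset ℕ → ℤ) (d : ℕ) :
    coeff d (binomialMoment r e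
      (partitionSeries fun s ↦ ((oneAddEps ^ stat s : ℤ⟦X⟧ˣ) : ℤ⟦X⟧))) =
        ∑ p : d.Partition, Ring.choose (stat p.parts + e) r := by
  simp only [coeff_binomialMoment, coeff_partitionSeries, val_oneAddEps_zpow, mul_sum, map_sum,
    coeff_binomialSeries_mul]

theorem coeff_binomialMoment_C_mul_X (r : ℕ) (e m : ℤ) (d : ℕ) :
    coeff d (binomialMoment r e (C (binomialSeries ℤ m) * X)) =
      if d = 1 then Ring.choose (m + e) r else 0 := by
  rw [coeff_binomialMoment, coeff_C_mul, coeff_X]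
  split_ifs
  · rw [mul_one, coeff_binomialSeries_mul]
  · simp only [mul_zero, map_zero]

end BinomialMoments

section CrankTailMoments

/-- The Lambert summand `q^n / (1 - q^n)²`. -/
noncomputable def lambertTerm (n : ℕ) : ℤ⟦X⟧ := X ^ n * ((1 - X ^ n) ^ 2)⁻¹ʳ

/-- The generating function of the rank at `z = 1 + ε`. -/
noncomputable def rankGenFun : ℤ⟦X⟧⟦X⟧ :=
  partitionSeries fun s ↦ ((oneAddEps ^ partsRank s : ℤ⟦X⟧ˣ) : ℤ⟦X⟧)

/-- The generating function of the crank at `z = 1 + ε`, with the conventional values of `M m 1`. -/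
noncomputable def crankGenFun : ℤ⟦X⟧⟦X⟧ :=
  crankSeries (C (oneAddEps : ℤ⟦X⟧)) (C ((oneAddEps⁻¹ : ℤ⟦X⟧ˣ) : ℤ⟦X⟧))

/-- The tail `crankTail z z⁻¹ n` of the crank product at `z = 1 + ε`. -/
noncomputable def crankTailGenFun (n : ℕ) : ℤ⟦X⟧⟦X⟧ :=
  crankTail (C (oneAddEps : ℤ⟦X⟧)) (C ((oneAddEps⁻¹ : ℤ⟦X⟧ˣ) : ℤ⟦X⟧)) n

theorem isUnit_one_sub_X_pow_sq {n : ℕ} (hn : n ≠ 0) : IsUnit ((1 - (X : ℤ⟦X⟧) ^ n) ^ 2) :=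
  (isUnit_one_sub_of_X_dvd (dvd_pow_self X hn)).pow 2

theorem map_C_lambertTerm {n : ℕ} (hn : n ≠ 0) :
    PowerSeries.map (C : ℤ →+* ℤ⟦X⟧) (lambertTerm n) = X ^ n * ((1 - X ^ n) ^ 2)⁻¹ʳ := by
  rw [lambertTerm, map_mul, map_inverse_of_isUnit _ (isUnit_one_sub_X_pow_sq hn)]
  simp only [map_pow, map_sub, map_one, map_X]

theorem continuous_map_C : Continuous (PowerSeries.map (C : ℤ →+* ℤ⟦X⟧)) := by
  refine continuous_iff_continuousAt.2 fun f ↦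
    (WithPiTopology.tendsto_iff_coeff_tendsto ℤ⟦X⟧ _ _ _).2 fun d ↦ ?_
  simp only [coeff_map]
  exact ((continuous_of_discreteTopology (f := (C : ℤ →+* ℤ⟦X⟧))).comp
    (WithPiTopology.continuous_coeff ℤ d)).tendsto f

theorem map_C_qProdInf (n : ℕ) :
    PowerSeries.map (C : ℤ →+* ℤ⟦X⟧) (qProdInf (X ^ n)) = qProdInf (X ^ n) := by
  refine ((hasProd_qProdInf (X ^ n)).map _ continuous_map_C).unique ?_
  exact (hasProd_qProdInf (X ^ n)).congr_fun fun i ↦ by simp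

theorem map_C_inverse_qProdInf (n : ℕ) :
    PowerSeries.map (C : ℤ →+* ℤ⟦X⟧) (qProdInf (X ^ n))⁻¹ʳ = (qProdInf (X ^ n))⁻¹ʳ := by
  rw [map_inverse_of_isUnit _ (isUnit_qProdInf _), map_C_qProdInf]

theorem crankTailGenFun_sub_succ (n : ℕ) :
    crankTailGenFun n - crankTailGenFun (n + 1) =
      C secondDiff * (PowerSeries.map C (lambertTerm (n + 1)) * crankTailGenFun n) := by
  have hunit : C (oneAddEps : ℤ⟦X⟧) * C ((oneAddEps⁻¹ : ℤ⟦X⟧ˣ) : ℤ⟦X⟧) = 1 := by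
    rw [← map_mul, oneAddEps.mul_inv, map_one]
  rw [crankTailGenFun, crankTailGenFun, crankTail_sub_crankTail_succ hunit,
    map_C_lambertTerm n.succ_ne_zero, secondDiff, map_add, map_sub, map_ofNat]

theorem hasSum_binomialMoment_crankTailGenFun (r : ℕ) (e : ℤ) (n : ℕ) :
    HasSum (fun i ↦ binomialMoment r e (C secondDiff *
        (PowerSeries.map C (lambertTerm (n + i + 1)) * crankTailGenFun (n + i))))
      (binomialMoment r e (crankTailGenFun n) - C (Ring.choose e r)) := by
  have hsum := (hasSum_crankTail_sub_succ (C (oneAddEps : ℤ⟦X⟧))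
    (C ((oneAddEps⁻¹ : ℤ⟦X⟧ˣ) : ℤ⟦X⟧)) n).map _ (continuous_binomialMoment r e)
  rw [map_sub, binomialMoment_one] at hsum
  refine hsum.congr_fun fun i ↦ ?_
  rw [← crankTailGenFun_sub_succ]
  rfl

theorem binomialMoment_crankTailGenFun_of_lt {r : ℕ} (hr : r < 2) (e : ℤ) (n : ℕ) :
    binomialMoment r e (crankTailGenFun n) = C (Ring.choose e r) := by
  have hsum := hasSum_binomialMoment_crankTailGenFun r e n
  simp only [binomialMoment_secondDiff_mul_of_lt hr] at hsum
  exact sub_eq_zero.1 (hsum.unique hasSum_zero)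

theorem hasSum_crankGenFun_sub_rankGenFun :
    HasSum (fun n ↦ C secondDiff * (PowerSeries.map C (lambertTerm (n + 1) *
        (qProdInf (X ^ (n + 1)))⁻¹ʳ) * crankTailGenFun n)) (crankGenFun - rankGenFun) := by
  have hval : crankGenFun - rankGenFun = crankGenFun - 1 -
      rankSeries (C (oneAddEps : ℤ⟦X⟧)) (C ((oneAddEps⁻¹ : ℤ⟦X⟧ˣ) : ℤ⟦X⟧)) := by
    rw [rankGenFun, partitionSeries_zpow_partsRank, sub_sub]
  have hsum := hasSum_crankSeries_sub_rankSeries (C (oneAddEps : ℤ⟦X⟧))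
    (C ((oneAddEps⁻¹ : ℤ⟦X⟧ˣ) : ℤ⟦X⟧))
  rw [hval]
  refine hsum.congr_fun fun n ↦ ?_
  have hsub := crankTailGenFun_sub_succ n
  rw [crankTailGenFun, crankTailGenFun] at hsub
  rw [hsub, map_mul, map_C_inverse_qProdInf, crankTailGenFun]
  ring

theorem crankGenFun_eq : crankGenFun =
    PowerSeries.map C (qProdInf 1)⁻¹ʳ * crankTailGenFun 0 := by
  rw [← pow_zero X, map_C_inverse_qProdInf, pow_zero, crankTailGenFun, crankTail_zero,
    ← crankGenFun, ← mul_assoc, Ring.inverse_mul_cancel _ (isUnit_qProdInf _), one_mul]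

end CrankTailMoments

section SymmetrizedMoments

/-- The operator turning the rank and crank generating functions at `z = 1 + ε` into those of the
symmetrized moments of order `2 * k`; multiplication by `z - 2 + z⁻¹` lowers `k` by one. -/
noncomputable def symmMoment (k : ℕ) : ℤ⟦X⟧⟦X⟧ →+ ℤ⟦X⟧ := binomialMoment (2 * k) ((k : ℤ) - 1)

theorem symmMoment_succ (k : ℕ) : symmMoment (k + 1) = binomialMoment (2 * k + 2) (k - 1 + 1) := by
  rw [symmMoment, mul_add_one, Nat.cast_add_one, add_sub_right_comm]

theorem symmMoment_succ_secondDiff_mul (k : ℕ) (g : ℤ⟦X⟧) (f : ℤ⟦X⟧⟦X⟧) :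
    symmMoment (k + 1) (C secondDiff * (PowerSeries.map C g * f)) = g * symmMoment k f := by
  rw [symmMoment_succ, binomialMoment_secondDiff_mul, binomialMoment_map_C_mul, symmMoment]

theorem symmMoment_zero_crankTailGenFun (n : ℕ) : symmMoment 0 (crankTailGenFun n) = 1 := by
  rw [symmMoment, binomialMoment_crankTailGenFun_of_lt (by simp), mul_zero,
    Ring.choose_zero_right, map_one]

theorem hasSum_symmMoment_succ_crankTailGenFun (k n : ℕ) :
    HasSum (fun i ↦ lambertTerm (n + i + 1) * symmMoment k (crankTailGenFun (n + i)))
      (symmMoment (k + 1) (crankTailGenFun n)) := by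
  have hchoose : Ring.choose ((k : ℤ) - 1 + 1) (2 * k + 2) = 0 := by
    rw [sub_add_cancel, Ring.choose_natCast, Nat.choose_eq_zero_of_lt (by omega), Nat.cast_zero]
  have hsum := hasSum_binomialMoment_crankTailGenFun (2 * k + 2) (k - 1 + 1) n
  rw [hchoose, map_zero, sub_zero, ← symmMoment_succ] at hsum
  exact hsum.congr_fun fun i ↦ (symmMoment_succ_secondDiff_mul k _ _).symm

theorem hasSum_symmMoment_crankGenFun_sub (k : ℕ) :
    HasSum (fun n ↦ lambertTerm (n + 1) * (qProdInf (X ^ (n + 1)))⁻¹ʳ *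
        symmMoment k (crankTailGenFun n))
      (symmMoment (k + 1) crankGenFun - symmMoment (k + 1) rankGenFun) := by
  rw [← map_sub]
  exact (hasSum_crankGenFun_sub_rankGenFun.map _ (continuous_binomialMoment _ _)).congr_fun
    fun n ↦ (symmMoment_succ_secondDiff_mul k _ _).symm

theorem symmMoment_crankGenFun (k : ℕ) :
    symmMoment k crankGenFun = (qProdInf 1)⁻¹ʳ * symmMoment k (crankTailGenFun 0) := by
  rw [crankGenFun_eq, symmMoment, binomialMoment_map_C_mul]

theorem coeff_symmMoment_rankGenFun (k d : ℕ) :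
    coeff d (symmMoment k rankGenFun) = eta (2 * k) d := by
  rw [eta_two_mul, symmMoment, rankGenFun, coeff_binomialMoment_partitionSeries]
  rfl

theorem coeff_symmMoment_crankGenFun (k d : ℕ) :
    coeff d (symmMoment k crankGenFun) = mu (2 * k) d := by
  have hcrank : crankGenFun =
      partitionSeries (fun s ↦ ((oneAddEps ^ partsCrank s : ℤ⟦X⟧ˣ) : ℤ⟦X⟧)) +
        (C (binomialSeries ℤ (1 : ℤ)) * X - C (binomialSeries ℤ (0 : ℤ)) * X) := by
    rw [partitionSeries_zpow_partsCrank, ← val_oneAddEps_zpow, ← val_oneAddEps_zpow, zpow_one,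
      zpow_zero, Units.val_one, map_one, ← crankGenFun]
    ring
  rw [mu_two_mul, symmMoment, hcrank, map_add, map_sub, map_add, map_sub,
    coeff_binomialMoment_partitionSeries, coeff_binomialMoment_C_mul_X,
    coeff_binomialMoment_C_mul_X]
  split_ifs
  · rfl
  · rw [sub_zero]
    rfl

end SymmetrizedMoments

section MultipleSum

/-- The index type of the multiple sums: weakly increasing `k`-tuples with all entries greater
than `n`. The strict bound makes `Index k` definitionally `MonoTuple k 0`. -/
abbrev MonoTuple (k n : ℕ) : Type := {f : Fin k → ℕ // Monotone f ∧ ∀ i, n < f i}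

namespace MonoTuple

/-- The tuple with least entry `n + i + 1` and remaining entries `g`. -/
def cons {k n : ℕ} (i : ℕ) (g : MonoTuple k (n + i)) : MonoTuple (k + 1) n where
  val := Fin.cons (n + i + 1) g.1
  property := by
    constructor
    · intro a b
      induction a using Fin.cases <;> induction b using Fin.cases
      · simp
      · simpa using g.2.2 _
      · simp
      · simpa using @g.2.1 _ _
    · refine Fin.cases ?_ fun a ↦ ?_
      · simp
      · simpa using (Nat.le_add_right n i).trans_lt (g.2.2 a)

theorem cons_injective (k n : ℕ) :
    Function.Injective fun x : Σ i : ℕ, MonoTuple k (n + i) ↦ cons x.1 x.2 := by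
  rintro ⟨i, g, hg⟩ ⟨j, g', hg'⟩ h
  have hcons : (Fin.cons (n + i + 1) g : Fin (k + 1) → ℕ) = Fin.cons (n + j + 1) g' :=
    congrArg Subtype.val h
  obtain ⟨hij, rfl⟩ := Fin.cons_inj.1 hcons
  obtain rfl : i = j := by omega
  rfl

theorem cons_surjective (k n : ℕ) :
    Function.Surjective fun x : Σ i : ℕ, MonoTuple k (n + i) ↦ cons x.1 x.2 := by
  rintro ⟨f, hmono, hlt⟩
  obtain ⟨i, hi⟩ := Nat.exists_eq_add_of_lt (hlt 0)
  refine ⟨⟨i, Fin.tail f, hmono.comp (Fin.strictMono_succ.monotone), fun a ↦ ?_⟩, ?_⟩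
  · exact Nat.lt_of_succ_le (hi.symm.trans_le (hmono (Fin.zero_le a.succ)))
  · refine Subtype.ext ?_
    simp only [cons, ← hi, Fin.cons_self_tail]

/-- A nonempty weakly increasing tuple amounts to its least entry followed by its tail. -/
noncomputable def consEquiv (k n : ℕ) : (Σ i : ℕ, MonoTuple k (n + i)) ≃ MonoTuple (k + 1) n :=
  Equiv.ofBijective (fun x ↦ cons x.1 x.2) ⟨cons_injective k n, cons_surjective k n⟩

variable {R : Type*} [CommRing R] [TopologicalSpace R]

theorem summable_of_X_pow_sum_dvd {k n : ℕ} {F : MonoTuple k n → R⟦X⟧}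
    (hF : ∀ f, X ^ (∑ i, f.1 i) ∣ F f) : Summable F := by
  refine summable_of_X_pow_dvd (fun f ↦ ∑ i, f.1 i) (fun d ↦ ?_) hF
  refine Set.Finite.of_finite_image (f := Subtype.val) ?_ Subtype.val_injective.injOn
  refine (Set.Finite.pi' (ι := Fin k) fun _ ↦ Set.finite_le_nat d).subset ?_
  rintro _ ⟨f, hf, rfl⟩ i
  exact (single_le_sum (fun _ _ ↦ Nat.zero_le _) (mem_univ i)).trans hf

theorem hasSum_of_hasSum_cons [T2Space R] [IsTopologicalRing R] {k n : ℕ}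
    {F : MonoTuple (k + 1) n → R⟦X⟧} {G : ℕ → R⟦X⟧} {a : R⟦X⟧}
    (hF : ∀ f, X ^ (∑ i, f.1 i) ∣ F f) (hG : HasSum G a)
    (hFG : ∀ i, HasSum (fun g : MonoTuple k (n + i) ↦ F (cons i g)) (G i)) : HasSum F a := by
  rw [← (consEquiv k n).hasSum_iff]
  exact HasSum.sigma_of_hasSum hG hFG
    ((consEquiv k n).summable_iff.2 (summable_of_X_pow_sum_dvd hF))

end MonoTuple

theorem X_pow_sum_dvd_prod_lambertTerm {k : ℕ} (f : Fin k → ℕ) :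
    X ^ (∑ i, f i) ∣ ∏ i, lambertTerm (f i) := by
  rw [← prod_pow_eq_pow_sum]
  exact prod_dvd_prod_of_dvd _ _ fun i _ ↦ Dvd.intro _ rfl

theorem hasSum_prod_lambertTerm (k n : ℕ) :
    HasSum (fun f : MonoTuple k n ↦ ∏ i, lambertTerm (f.1 i))
      (symmMoment k (crankTailGenFun n)) := by
  induction k generalizing n with
  | zero =>
    have : Unique (MonoTuple 0 n) :=
      { default := ⟨fun i ↦ i.elim0, fun i ↦ i.elim0, fun i ↦ i.elim0⟩
        uniq := fun f ↦ Subtype.ext (funext fun i ↦ i.elim0) }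
    simp [symmMoment_zero_crankTailGenFun]
  | succ k ih =>
    refine MonoTuple.hasSum_of_hasSum_cons (fun f ↦ X_pow_sum_dvd_prod_lambertTerm f.1)
      (hasSum_symmMoment_succ_crankTailGenFun k n) fun i ↦ ?_
    refine ((ih (n + i)).mul_left (lambertTerm (n + i + 1))).congr_fun fun g ↦ ?_
    simp only [MonoTuple.cons, Fin.prod_univ_succ, Fin.cons_zero, Fin.cons_succ]

theorem inverse_prod {ι A : Type*} [CommMonoidWithZero A] (s : Finset ι) (f : ι → A) :
    (∏ i ∈ s, f i)⁻¹ʳ = ∏ i ∈ s, (f i)⁻¹ʳ :=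
  map_prod MonoidWithZero.inverse f s

theorem qPochInf_X_pow_succ (n : ℕ) : qPochInf (X ^ (n + 1)) = qProdInf (X ^ n) := by
  rw [qPochInf, qProdInf]
  exact tprod_congr fun i ↦ by ring

theorem summand_eq {k : ℕ} (hk : 1 ≤ k) (n : Index k) :
    summand hk n = (∏ i, lambertTerm (n.1 i)) * (qProdInf (X ^ n.1 ⟨0, hk⟩))⁻¹ʳ := by
  have hconst (i : Fin k) : constantCoeff ((1 - (X : ℤ⟦X⟧) ^ n.1 i) ^ 2) = 1 := by
    simp [(Nat.one_le_iff_ne_zero.1 (n.2.2 i))]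
  rw [summand, qPochInf_X_pow_succ, invOfUnit_one_eq_inverse, Ring.mul_inverse_rev, inverse_prod,
    ← prod_pow_eq_pow_sum]
  · simp only [lambertTerm, prod_mul_distrib]
    ring
  · rw [map_mul, map_prod, prod_congr rfl fun i _ ↦ hconst i, prod_const_one, one_mul,
      constantCoeff_qProdInf]

theorem hasSum_summand (k : ℕ) :
    HasSum (fun n : Index (k + 1) ↦ summand (Nat.le_add_left 1 k) n)
      (symmMoment (k + 1) crankGenFun - symmMoment (k + 1) rankGenFun) := by
  refine MonoTuple.hasSum_of_hasSum_cons (n := 0) (fun f ↦ ?_)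
    (hasSum_symmMoment_crankGenFun_sub k) fun i ↦ ?_
  · rw [summand_eq]
    exact (X_pow_sum_dvd_prod_lambertTerm f.1).mul_right _
  · have htail : crankTailGenFun i = crankTailGenFun (0 + i) := by rw [zero_add]
    rw [htail]
    refine ((hasSum_prod_lambertTerm k (0 + i)).mul_left _).congr_fun fun g ↦ ?_
    rw [summand_eq, MonoTuple.cons, Fin.prod_univ_succ]
    simp only [Fin.mk_zero', Fin.cons_zero, Fin.cons_succ, zero_add]
    ring

end MultipleSum

section SecondMoment

variable {R : Type*} [CommRing R] [TopologicalSpace R] [IsTopologicalRing R]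

theorem hasSum_succ_mul_count (s : Multiset ℕ) :
    HasSum (fun a ↦ ((a + 1 : ℕ) : R) * s.count (a + 1)) s.sum := by
  have hsum : HasSum (fun a : ℕ ↦ (a : R) * s.count a) s.sum := by
    have hval : ((s.sum : ℕ) : R) = ∑ a ∈ s.toFinset, (a : R) * s.count a := by
      rw [sum_multiset_count, Nat.cast_sum]
      exact sum_congr rfl fun a _ ↦ by rw [smul_eq_mul, Nat.cast_mul, mul_comm]
    rw [hval]
    refine hasSum_sum_of_ne_finset_zero fun a ha ↦ ?_
    rw [Multiset.count_eq_zero.2 (mt Multiset.mem_toFinset.2 ha), Nat.cast_zero, mul_zero]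
  simpa using (hasSum_nat_add_iff' 1).2 hsum

variable [T2Space R]

theorem hasSum_partitionSeries_sum :
    HasSum (fun a : ℕ ↦ ((a + 1 : ℕ) : R⟦X⟧) * (X ^ (a + 1) * (1 - X ^ (a + 1))⁻¹ʳ) *
      (qProdInf 1)⁻¹ʳ) (partitionSeries fun s ↦ (s.sum : R)) := by
  have hterm (a : ℕ) : ((a + 1 : ℕ) : R⟦X⟧) * (X ^ (a + 1) * (1 - X ^ (a + 1))⁻¹ʳ) *
      (qProdInf 1)⁻¹ʳ = partitionSeries fun s ↦ ((a + 1 : ℕ) : R) * s.count (a + 1) := by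
    rw [partitionSeries_const_mul, partitionSeries_count a.succ_pos, partitionSeries_one,
      map_natCast, mul_assoc]
  refine HasSum.congr_fun ?_ hterm
  rw [WithPiTopology.hasSum_iff_hasSum_coeff]
  simp only [coeff_partitionSeries]
  exact fun d ↦ hasSum_sum fun p _ ↦ hasSum_succ_mul_count p.parts

theorem partitionSeries_count_forall_lt (n : ℕ) :
    partitionSeries (fun s ↦ if ∀ a ∈ s, n < a then (s.count (n + 1) + 1 : R) else 0) =
      ((1 - X ^ (n + 1)) ^ 2)⁻¹ʳ * (qProdInf (X ^ (n + 1)))⁻¹ʳ := by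
  have hcount := partitionSeries_count_succ_mul (R := R) n.succ_pos
    (wt := fun s ↦ if ∀ a ∈ s, n < a then 1 else 0) fun s ↦ by
      simp only [Multiset.forall_mem_cons, Nat.lt_succ_self, true_and]
  simp only [mul_ite, mul_one, mul_zero] at hcount
  rw [hcount, partitionSeries_forall_lt, qProdInf_X_pow, sq, Ring.mul_inverse_rev,
    Ring.mul_inverse_rev]
  ring

theorem hasSum_spt :
    HasSum (fun n ↦ lambertTerm (n + 1) * (qProdInf (X ^ (n + 1)))⁻¹ʳ)
      (PowerSeries.mk fun d ↦ (spt d : ℤ)) := by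
  have hspt : PowerSeries.mk (fun d ↦ (spt d : ℤ)) =
      partitionSeries fun s ↦ (s.count (sInf {a | a ∈ s}) : ℤ) := by
    ext d
    rw [coeff_mk, coeff_partitionSeries, spt, Nat.cast_sum]
  have hsum := hasSum_partitionSeries_smallest_part
    fun s : Multiset ℕ ↦ (s.count (sInf {a | a ∈ s}) : ℤ)
  rw [Multiset.count_zero, Nat.cast_zero, map_zero, sub_zero, ← hspt] at hsum
  refine hsum.congr_fun fun n ↦ ?_
  rw [lambertTerm, mul_assoc, ← partitionSeries_count_forall_lt]
  refine congrArg _ (partitionSeries_congr fun s _ ↦ if_ctx_congr Iff.rfl (fun hs ↦ ?_)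
    fun _ ↦ rfl)
  rw [(sInf_mem_cons_eq_iff n s).2 hs, Multiset.count_cons_self, Nat.cast_add_one]

theorem spt_eq (n : ℕ) : (spt n : ℤ) = mu 2 n - eta 2 n := by
  have hsum := hasSum_symmMoment_crankGenFun_sub 0
  simp only [symmMoment_zero_crankTailGenFun, mul_one, zero_add] at hsum
  have hcoeff := congrArg (coeff n) (hasSum_spt.unique hsum)
  rwa [coeff_mk, map_sub, coeff_symmMoment_crankGenFun, coeff_symmMoment_rankGenFun] at hcoeff

theorem binomialMoment_one_rankGenFun : binomialMoment 1 0 rankGenFun = 0 := by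
  have hsum := hasSum_crankGenFun_sub_rankGenFun.map _ (continuous_binomialMoment 1 0)
  simp only [Function.comp_def, binomialMoment_secondDiff_mul_of_lt one_lt_two] at hsum
  have hcrank : binomialMoment 1 0 crankGenFun = 0 := by
    rw [crankGenFun_eq, binomialMoment_map_C_mul, binomialMoment_crankTailGenFun_of_lt one_lt_two,
      Ring.choose_one_right, map_zero, mul_zero]
  have hzero := hsum.unique hasSum_zero
  rwa [map_sub, hcrank, zero_sub, neg_eq_zero] at hzero

theorem sum_rank_eq_zero (n : ℕ) : ∑ p : n.Partition, rank p = 0 := by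
  have hcoeff := congrArg (coeff n) binomialMoment_one_rankGenFun
  rw [rankGenFun, coeff_binomialMoment_partitionSeries, map_zero] at hcoeff
  simp only [add_zero, Ring.choose_one_right] at hcoeff
  exact hcoeff

theorem two_mul_choose_two (m : ℤ) : 2 * Ring.choose m 2 = m * (m - 1) := by
  have h := Ring.descPochhammer_eq_factorial_smul_choose m 2
  simpa [descPochhammer_succ_right, Polynomial.smeval_mul, Polynomial.smeval_sub,
    Polynomial.smeval_X] using h.symm

theorem two_mul_eta_two (n : ℕ) : 2 * eta 2 n = rankMomentTwo n := by
  calc 2 * eta 2 n = 2 * ∑ p : n.Partition, Ring.choose (rank p) 2 := by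
        simpa using eta_two_mul 1 n
    _ = ∑ p : n.Partition, (rank p ^ 2 - rank p) := by
        rw [mul_sum]
        exact sum_congr rfl fun p _ ↦ by rw [two_mul_choose_two, mul_sub_one, sq]
    _ = ∑ p : n.Partition, rank p ^ 2 := by rw [sum_sub_distrib, sum_rank_eq_zero, sub_zero]
    _ = rankMomentTwo n := (sum_mul_N n (· ^ 2)).symm

theorem hasSum_succ_mul_X_pow_div :
    HasSum (fun m : ℕ ↦ ((m + 1 : ℕ) : ℤ⟦X⟧) * (X ^ (m + 1) * (1 - X ^ (m + 1))⁻¹ʳ))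
      (symmMoment 1 (crankTailGenFun 0)) := by
  have hX (m : ℕ) : (X : ℤ⟦X⟧) ∣ X ^ (m + 1) := dvd_pow_self X m.succ_ne_zero
  have hcol := hasSum_symmMoment_succ_crankTailGenFun 0 0
  simp only [symmMoment_zero_crankTailGenFun, mul_one, zero_add] at hcol
  refine hasSum_comm_of_X_pow_dvd
    (f := fun m c ↦ ((m + 1 : ℕ) : ℤ⟦X⟧) * X ^ ((m + 1) * (c + 1)))
    (fun m c ↦ (pow_dvd_pow X (by nlinarith)).mul_left _) (fun m ↦ ?_) (fun c ↦ ?_) hcol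
  · exact ((hasSum_pow_succ (hX m)).mul_left _).congr_fun fun c ↦ by rw [pow_mul]
  · exact (hasSum_succ_mul_pow_succ (hX c)).congr_fun fun m ↦ by rw [mul_comm (m + 1), pow_mul]

theorem mu_two (n : ℕ) : mu 2 n = (n : ℤ) * Fintype.card n.Partition := by
  have hsum := hasSum_partitionSeries_sum.unique
    (hasSum_succ_mul_X_pow_div.mul_right (qProdInf 1)⁻¹ʳ)
  rw [mul_comm, ← symmMoment_crankGenFun] at hsum
  have hcoeff := congrArg (coeff n) hsum
  simp only [coeff_partitionSeries, coeff_symmMoment_crankGenFun, Nat.Partition.parts_sum,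
    sum_const, card_univ, nsmul_eq_mul] at hcoeff
  rw [← hcoeff, mul_comm]

theorem mu_zero_eq_eta_zero (k : ℕ) : mu (2 * k) 0 = eta (2 * k) 0 := by
  rw [mu_two_mul, eta_two_mul, if_neg zero_ne_one, add_zero]
  exact sum_congr rfl fun p _ ↦ by simp [crank, rank]

end SecondMoment

end SptK

theorem mainTheorem1 :
    (∀ (k : ℕ) (hk : 1 ≤ k),
      HasSum (fun n : SptK.Index k => SptK.summand hk n)
        (PowerSeries.mk fun n : ℕ =>
          if 1 ≤ n then SptK.mu (2 * k) n - SptK.eta (2 * k) n else 0)) ∧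
    (∀ n : ℕ, 1 ≤ n →
      (SptK.spt n : ℚ) =
        (n : ℚ) * (Fintype.card n.Partition : ℚ) - (SptK.rankMomentTwo n : ℚ) / 2) := by
  refine ⟨fun k hk ↦ ?_, fun n _ ↦ ?_⟩
  · obtain ⟨k, rfl⟩ := Nat.exists_eq_add_of_le' hk
    have hcoeff : (PowerSeries.mk fun n ↦
        if 1 ≤ n then SptK.mu (2 * (k + 1)) n - SptK.eta (2 * (k + 1)) n else 0) =
        SptK.symmMoment (k + 1) SptK.crankGenFun - SptK.symmMoment (k + 1) SptK.rankGenFun := by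
      ext (_ | d)
      · simp [-coeff_zero_eq_constantCoeff, SptK.coeff_symmMoment_crankGenFun,
          SptK.coeff_symmMoment_rankGenFun, SptK.mu_zero_eq_eta_zero]
      · simp [SptK.coeff_symmMoment_crankGenFun, SptK.coeff_symmMoment_rankGenFun]
    exact hcoeff ▸ SptK.hasSum_summand k
  · have hspt := SptK.spt_eq n
    rw [SptK.mu_two] at hspt
    have hrank : (2 : ℚ) * SptK.eta 2 n = SptK.rankMomentTwo n := by
      exact_mod_cast SptK.two_mul_eta_two n
    rw [← hrank, mul_div_cancel_left₀ _ two_ne_zero]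
    exact_mod_cast hspt
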